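/- **Setting.** Let $D$ be the space of càdlàg functions $[0,\infty)\to\mathbb R$, with the $\sigma$-field generated by the evaluations. Let $(b,\eta)$ be defined on a probability space $(S,\nu)$, where $b=(b(t))_{t\ge 0}$ is a jointly measurable $\mathbb R_+$-valued process (birth rate) and $\eta\ge 0$ is a random variable (lifetime); $b$ and $\eta$ may be dependent. Let $L$ (number of twins at a birth event) be a random variable with values in $\{0,1,2,\dots\}$ and let $\pi$ be a probability law on $D$. Let $\Pi$ be the law on $\mathbb Z_+\times D^\infty$ of $(L,Z^{1},Z^{2},\dots)$, where all entries are independent and every $Z^{i}$ has law $\pi$, and let $\mu(ds,du,d\mathbf z)=ds\,du\,\Pi(d\mathbf z)$ on $\mathbb R_+\times\mathbb R_+\times(\mathbb Z_+\times D^\infty)$; write $\mathbf z=(\ell,z_1,z_2,\dots)$. On a probability space $(\Omega,\mathcal F,\mathbb P)$ let, for $k\ge 1$, $X_k$ be an $S$-valued random variable of law $\nu$, let $b_k(t)=b(t,X_k)$, $\eta_k=\eta(X_k)$ (copies of $(b,\eta)$), and let $\mathcal M_k$ be a Poisson random measure with mean measure $\mu$, independent of $X_k$, the pairs $(X_k,\mathcal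 M_k)$, $k\ge 1$, being independent. Let $Z_k$ be the Crump–Mode–Jagers process (number of living descendants of one ancestor) driven by $(b_k,\eta_k,\mathcal M_k)$: $Z_k$ is a random element of $D$ whose law is $\pi$ and, almost surely, for all $t\ge 0$, $$Z_k(t)=\mathbf 1_{\eta_k>t}+\int_0^t\int_0^{b_k(s)}\int \sum_{i=1}^{\ell} z_i(t-s)\,\mathcal M_k(ds,du,d\mathbf z).$$ Write $Z$ for a process of law $\pi$ and $M_1(t)=\mathbb E[Z(t)]$, $\bar b(t)=\mathbb E[b(t)]$, $\bar L=\mathbb E[L]$, $F^c(t)=\mathbb P(\eta>t)$, $\bar{\mathcal M}_k=\mathcal M_k-\mu$. For $x>0$, $N\ge1$ and $t\ge0$, with $[Nx]$ the integer part of $Nx$, let $$\mathcal U_1^{N,x}(t)=\sqrt{[Nx]}\Big(\frac1{[Nx]}\sum_{k=1}^{[Nx]}\mathbf 1_{\eta_k>t}-F^c(t)\Big),\qquad \mathcal U_2^{N,x}(t)=\frac1{\sqrt{[Nx]}}\sum_{k=1}^{[Nx]}\int_0^t (b_k(s)-\bar b(s))\,\bar L\,M_1(t-s)\,ds,$$ $$\mathcal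 U_3^{N,x}(t)=\frac1{\sqrt{[Nx]}}\sum_{k=1}^{[Nx]}\int_0^t\int_0^{b_k(s)}\int\sum_{i=1}^\ell z_i(t-s)\,\bar{\mathcal M}_k(ds,du,d\mathbf z).$$ **Proposition.** Assume that $\mathbb E[L^2]<\infty$ and that $\sup_{0<t<T}\mathbb E[b(t)^2]<\infty$ for every $T>0$. Then, for every $x>0$, as $N\to\infty$ the finite-dimensional distributions of $(\mathcal U_1^{N,x},\mathcal U_2^{N,x},\mathcal U_3^{N,x})$ converge to those of a centered Gaussian process $(\mathcal U_1,\mathcal U_2,\mathcal U_3)$ whose covariances are given, for all $t,s\ge0$, by $$\operatorname{Cov}(\mathcal U_1(t),\mathcal U_1(s))=F^c(t\vee s)-F^c(t)F^c(s),$$ $$\operatorname{Cov}(\mathcal U_2(t),\mathcal U_2(s))=\int_0^t\int_0^s\bar L^2M_1(t-r)M_1(s-u)\operatorname{Cov}(b(r),b(u))\,du\,dr,$$ $$\operatorname{Cov}(\mathcal U_3(t),\mathcal U_3(s))=\int_0^{t\wedge s}\bar b(r)\big\{\bar L\,\mathbb E[Z(t-r)Z(s-r)]+\mathbb E[L^2-L]\,M_1(t-r)M_1(s-r)\big\}dr,$$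 $$\operatorname{Cov}(\mathcal U_1(t),\mathcal U_3(s))=\operatorname{Cov}(\mathcal U_2(t),\mathcal U_3(s))=0,\qquad \operatorname{Cov}(\mathcal U_1(t),\mathcal U_2(s))=\int_0^s\bar L\,M_1(s-r)\operatorname{Cov}(b(r),\mathbf 1_{\eta>t})\,dr.$$ -/

import Mathlib

open MeasureTheory ProbabilityTheory Filter Topology Set
open scoped NNReal ENNReal

noncomputable section

namespace CMJ

/-- Lebesgue measure on `[0, ∞)`. -/
def leb : Measure ℝ≥0 := (volume.restrict (Ici (0 : ℝ))).map Real.toNNReal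

/-- The space `D([0, ∞), ℝ)` of càdlàg functions. Its measurable structure (inherited from the
subtype of a product) is the one generated by the evaluations, which is the Borel sigma-field of
the Skorokhod topology. -/
abbrev Path : Type :=
  {z : ℝ≥0 → ℝ // ∀ t, ContinuousWithinAt z (Ici t) t ∧ ∃ l, Tendsto z (𝓝[<] t) (𝓝 l)}

/-- Marks `(ℓ, z₁, z₂, …)`: a number of twins and a sequence of càdlàg functions.
The function `z_{i+1}` is the entry of index `i`. -/
abbrev Mark : Type := ℕ × (ℕ → Path)

/-- Points `(s, u, (ℓ, z₁, z₂, …))` of `ℝ₊ × ℝ₊ × (ℕ × D^∞)`. -/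
abbrev Point : Type := ℝ≥0 × ℝ≥0 × Mark

/-- The law `Π` of `(L, Z₁, Z₂, …)`, all entries independent, `L` with law `lam` and every `Zᵢ`
with law `π`. -/
def markLaw (lam : Measure ℕ) (π : Measure Path) : Measure Mark :=
  lam.prod (Measure.infinitePi fun _ : ℕ => π)

/-- The mean measure `ds du Π(dz)`. -/
def intensity (lam : Measure ℕ) (π : Measure Path) : Measure Point :=
  leb.prod (leb.prod (markLaw lam π))

/-- `M` is a Poisson random measure with mean measure `μ`. -/
structure IsPoissonRandomMeasure {Ω E : Type*} [MeasurableSpace Ω] [MeasurableSpace E]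
    (M : Ω → Measure E) (μ : Measure E) (P : Measure Ω) : Prop where
  measurable : Measurable M
  poisson : ∀ A : Set E, MeasurableSet A → μ A ≠ ∞ →
    P.map (fun ω => M ω A) =
      (poissonMeasure (μ A).toNNReal).map (fun n : ℕ => (n : ℝ≥0∞))
  infinite : ∀ A : Set E, MeasurableSet A → μ A = ∞ → ∀ᵐ ω ∂P, M ω A = ∞
  indep : ∀ (n : ℕ) (A : Fin n → Set E), (∀ i, MeasurableSet (A i)) →
    Pairwise (fun i j => Disjoint (A i) (A j)) → iIndepFun (fun i ω => M ω (A i)) P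

/-- For a birth rate function `β`, the integral
`∫₀ᵗ ∫₀^{β(s)} ∫ ∑_{i=1}^ℓ zᵢ(t - s) m(ds, du, dz)` with respect to a measure `m`. -/
def pointIntegral (β : ℝ≥0 → ℝ≥0) (t : ℝ≥0) (m : Measure Point) : ℝ :=
  ∫ a in {a : Point | a.1 ≤ t ∧ a.2.1 ≤ β a.1},
    ∑ i ∈ Finset.range a.2.2.1, (a.2.2.2 i).1 (t - a.1) ∂m

variable {S Ω : Type*} [MeasurableSpace S] [MeasurableSpace Ω]

/-- A sequence `(Z k)` of independent Crump-Mode-Jagers processes, each with a single ancestor.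

The pair `(b, η)` (birth rate process, lifetime) is given on a probability space `(S, ν)`; the
ancestor number `k` has a random type `X k` of law `ν`, and `(b · (X k ω), η (X k ω))` is its copy
of `(b, η)`. The law of the number of twins at a birth event is `lam`, and `π` is the law of the
process which counts the living descendants of one individual. The offspring of the ancestor number
`k` is described by a Poisson random measure `M k`, independent of `X k`, whose marks carry the
numbers of twins and the independent copies, with law `π`, of the process started by each child:
`Z(t) = 1_{η > t} + ∫₀ᵗ ∫₀^{b(s)} ∫ ∑_{i=1}^ℓ zᵢ(t - s) M(ds, du, dz)`. -/
structure IsCMJ (ν : Measure S) (b : ℝ≥0 → S → ℝ≥0) (η : S → ℝ≥0) (lam : Measure ℕ)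
    (π : Measure Path) (P : Measure Ω) (X : ℕ → Ω → S) (M : ℕ → Ω → Measure Point)
    (Z : ℕ → Ω → Path) : Prop where
  measurable_type : ∀ k, Measurable (X k)
  law_type : ∀ k, P.map (X k) = ν
  poisson : ∀ k, IsPoissonRandomMeasure (M k) (intensity lam π) P
  indep_type : ∀ k, IndepFun (X k) (M k) P
  indep_ancestors : iIndepFun (fun k ω => (X k ω, M k ω)) P
  measurable_path : ∀ k, Measurable (Z k)
  law_path : ∀ k, P.map (Z k) = π
  branching : ∀ k, ∀ᵐ ω ∂P, ∀ t : ℝ≥0,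
    (Z k ω).1 t =
      (if t < η (X k ω) then 1 else 0) + pointIntegral (fun s => b s (X k ω)) t (M k ω)

/-- `b̄(t) = E[b(t)]`. -/
def meanRate (ν : Measure S) (b : ℝ≥0 → S → ℝ≥0) (t : ℝ≥0) : ℝ := ∫ y, (b t y : ℝ) ∂ν

/-- `Fᶜ(t) = P(η > t)`. -/
def survival (ν : Measure S) (η : S → ℝ≥0) (t : ℝ≥0) : ℝ := ν.real {y | t < η y}

/-- `L̄ = E[L]`. -/
def meanTwins (lam : Measure ℕ) : ℝ := ∫ l, (l : ℝ) ∂lam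

/-- `M₁(t) = E[Z(t)]`. -/
def meanPop (π : Measure Path) (t : ℝ≥0) : ℝ := ∫ z, z.1 t ∂π

/-- The assumption `E[L²] < ∞` and `sup_{0 < t < T} E[b(t)²] < ∞` for every `T > 0`. -/
def SecondMoments (ν : Measure S) (b : ℝ≥0 → S → ℝ≥0) (lam : Measure ℕ) : Prop :=
  (∫⁻ l, (l : ℝ≥0∞) ^ 2 ∂lam) < ∞ ∧
    ∀ T : ℝ≥0, 0 < T → (⨆ t ∈ Ioo 0 T, ∫⁻ y, (b t y : ℝ≥0∞) ^ 2 ∂ν) < ∞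

/-- `𝒰₁(t)` for `n` ancestors. -/
def U₁ (ν : Measure S) (η : S → ℝ≥0) (X : ℕ → Ω → S) (n : ℕ) (t : ℝ≥0) (ω : Ω) : ℝ :=
  √n * (1 / n * ∑ k ∈ Finset.range n, (if t < η (X k ω) then (1 : ℝ) else 0) - survival ν η t)

/-- `𝒰₂(t)` for `n` ancestors. -/
def U₂ (ν : Measure S) (b : ℝ≥0 → S → ℝ≥0) (lam : Measure ℕ) (π : Measure Path)
    (X : ℕ → Ω → S) (n : ℕ) (t : ℝ≥0) (ω : Ω) : ℝ :=
  1 / √n * ∑ k ∈ Finset.range n,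
    ∫ s in Iic t, ((b s (X k ω) : ℝ) - meanRate ν b s) * meanTwins lam * meanPop π (t - s) ∂leb

/-- `𝒰₃(t)` for `n` ancestors: integrals with respect to the compensated random measures. -/
def U₃ (b : ℝ≥0 → S → ℝ≥0) (lam : Measure ℕ) (π : Measure Path)
    (X : ℕ → Ω → S) (M : ℕ → Ω → Measure Point) (n : ℕ) (t : ℝ≥0) (ω : Ω) : ℝ :=
  1 / √n * ∑ k ∈ Finset.range n,
    (pointIntegral (fun s => b s (X k ω)) t (M k ω) -
      pointIntegral (fun s => b s (X k ω)) t (intensity lam π))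

end CMJ

end

/-! With `n = ⌊N x⌋` ancestors, each of the three processes at a time `t` is `n^{-1/2}` times a sum
over `k` of one fixed function `dev (i, t)` of the pair `(X k, M k)`. These pairs are independent
with common law `ν ⊗ Q`, where `Q` is the law of a Poisson random measure; `Q` does not depend on
`k`, because the mean measure determines it (`IsPoissonRandomMeasure.map_eq`). Once the functions
`dev (i, t)` are centered and square integrable, the multivariate central limit theorem
`exists_gaussian_limit` gives the convergence. The limit is the image of the family `dev` under an
isonormal process over `L²(ν ⊗ Q)`, so its covariances are the `L²` inner products.

Square integrability rests on a local bound for `E[Z(t)²]`, and the branching equation serves only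
for this. It yields a renewal inequality for the truncated moments `E[min(|Z(t)|, K)²]`
(`IsCMJ.lintegral_min_sq_le`), which are finite a priori. Truncation passes inside the Poisson
integral because a set carries either no point or mass at least one (`ae_min_lintegral_le`).
`gronwall_convolution` then gives a bound uniform in `K`, and `K → ∞` concludes.

The covariances are computed conditionally on the type `X k`. Given the type, a compensated Poisson
integral is centered, hence orthogonal to every square integrable function of the type
(`integral_fst_mul_prod`), and the product of two of them has mean `∫ F G dμ`
(`integral_prod_mul_prod`). The latter comes from the second moment formula
`lintegral_lintegral_mul_lintegral`. The independent twins give the bracket with `L` and `L² - L`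
(`integral_sum_twins_mul_sum_twins`), and averaging over the type turns `b` into `b̄`. The remaining
covariances, which involve only lifetimes and rates, follow from Fubini. -/

noncomputable section

namespace CMJ

/-! ### Isonormal Gaussian process over a Hilbert space. -/

section Isonormal

/-- The law of a family of independent standard Gaussian variables. -/
abbrev stdGaussianFamily (ι : Type*) : Measure (ι → ℝ) :=
  Measure.infinitePi fun _ : ι => gaussianReal 0 1

lemma memLp_eval_stdGaussianFamily {ι : Type*} (i : ι) :
    MemLp (fun u : ι → ℝ => u i) 2 (stdGaussianFamily ι) :=
  MemLp.comp_measurePreserving (g := id) (memLp_id_gaussianReal 2)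
    (measurePreserving_eval_infinitePi (fun _ : ι => gaussianReal 0 1) i)

lemma integral_eval_stdGaussianFamily {ι : Type*} (i : ι) :
    ∫ u, u i ∂stdGaussianFamily ι = 0 := by
  have h := (measurePreserving_eval_infinitePi (fun _ : ι => gaussianReal 0 1) i).hasLaw
  have := h.integral_eq
  simpa using this

lemma integral_eval_mul_eval_stdGaussianFamily {ι : Type*} [DecidableEq ι] (i j : ι) :
    ∫ u, u i * u j ∂stdGaussianFamily ι = if i = j then 1 else 0 := by
  have hl (i : ι) := (measurePreserving_eval_infinitePi (fun _ : ι => gaussianReal 0 1) i).hasLaw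
  split_ifs with h
  · subst h
    have h1 := (hl i).variance_eq
    rw [variance_id_gaussianReal] at h1
    rw [variance_eq_integral (measurable_pi_apply i).aemeasurable] at h1
    simpa [integral_eval_stdGaussianFamily, sq] using h1
  · have hi : iIndepFun (fun (i : ι) (u : ι → ℝ) => u i) (stdGaussianFamily ι) :=
      iIndepFun_infinitePi (X := fun _ x => x) (fun _ => measurable_id)
    have := (hi.indepFun h).integral_fun_mul_eq_mul_integral
      (measurable_pi_apply i).aestronglyMeasurable (measurable_pi_apply j).aestronglyMeasurable
    simpa [integral_eval_stdGaussianFamily] using this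

/-- A Hilbert basis is sent to the coordinates of an independent standard Gaussian family, which are
orthonormal in `L²`. Finite combinations are Gaussian by independence, and the law of a general
image follows by closure. -/
lemma exists_isonormal {H : Type*} [NormedAddCommGroup H] [InnerProductSpace ℝ H]
    [CompleteSpace H] :
    ∃ (w : Set H) (W : H →ₗᵢ[ℝ] Lp ℝ 2 (stdGaussianFamily w)),
      ∀ h, (stdGaussianFamily w).map (W h) = gaussianReal 0 (‖h‖₊ ^ 2) := by
  classical
  obtain ⟨w, b, -⟩ := exists_hilbertBasis ℝ H
  set γ := stdGaussianFamily w
  let g (i : w) : Lp ℝ 2 γ := (memLp_eval_stdGaussianFamily i).toLp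
  have hg : Orthonormal ℝ g := by
    rw [orthonormal_iff_ite]
    intro i j
    rw [L2.inner_def, ← integral_eval_mul_eval_stdGaussianFamily i j]
    refine integral_congr_ae ?_
    filter_upwards [(memLp_eval_stdGaussianFamily i).coeFn_toLp,
      (memLp_eval_stdGaussianFamily j).coeFn_toLp] with u hi hj
    simp only [g, hi, hj]
    simp [mul_comm]
  have hV : OrthogonalFamily ℝ (fun _ : w => ℝ) fun i => LinearIsometry.toSpanSingleton ℝ _ (hg.1 i) :=
    hg.orthogonalFamily
  let W : H →ₗᵢ[ℝ] Lp ℝ 2 γ := hV.linearIsometry.comp b.repr.toLinearIsometry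
  have hWb (i : w) : W (b i) = g i := by
    change hV.linearIsometry (b.repr (b i)) = g i
    rw [b.repr_self i]
    exact (hV.linearIsometry_apply_single (1 : ℝ)).trans (one_smul ℝ (g i))
  refine ⟨w, W, ?_⟩
  -- `L²` convergence implies convergence in measure, hence in law; the Gaussian characteristic
  -- functions depend continuously on the norm.
  have hclosed : IsClosed {h : H | γ.map (W h) = gaussianReal 0 (‖h‖₊ ^ 2)} := by
    refine IsSeqClosed.isClosed fun x h hx hlim => ?_
    have h1 : TendstoInMeasure γ (fun n => (W (x n) : _ → ℝ)) atTop (W h) := by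
      refine tendstoInMeasure_of_tendsto_eLpNorm (p := 2) (by simp)
        (fun n => (Lp.aestronglyMeasurable _)) (Lp.aestronglyMeasurable _) ?_
      exact Lp.tendsto_Lp_iff_tendsto_eLpNorm' _ _ |>.1 ((W.continuous.tendsto h).comp hlim)
    have h2 := h1.tendstoInDistribution fun n => (Lp.aestronglyMeasurable _).aemeasurable
    have h3 := ProbabilityMeasure.tendsto_iff_tendsto_charFun.1 h2.tendsto
    have hp : IsProbabilityMeasure (γ.map (W h)) :=
      Measure.isProbabilityMeasure_map (Lp.aestronglyMeasurable _).aemeasurable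
    refine Measure.ext_of_charFun (funext fun t => ?_)
    refine tendsto_nhds_unique (h3 t) ?_
    have h4 (n : ℕ) : γ.map (W (x n)) = gaussianReal 0 (‖x n‖₊ ^ 2) := hx n
    simp only [ProbabilityMeasure.coe_mk, h4, charFun_gaussianReal]
    refine (Complex.continuous_exp.tendsto _).comp ?_
    refine Tendsto.sub tendsto_const_nhds ?_
    refine Tendsto.div_const (Tendsto.mul_const _ ?_) _
    simp only [NNReal.coe_pow, coe_nnnorm, Complex.ofReal_pow]
    exact ((Complex.continuous_ofReal.tendsto _).comp hlim.norm).pow 2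
  intro h
  refine hclosed.mem_of_tendsto (b.hasSum_repr h) (Eventually.of_forall fun s => ?_)
  set c : w → ℝ := fun i => b.repr h i
  have hWs : W (∑ i ∈ s, c i • b i) =ᵐ[γ] fun u => ∑ i ∈ s, c i * u i := by
    simp only [map_sum, map_smul, hWb]
    refine (Lp.coeFn_finsetSum _ _).trans ?_
    have : ∀ᵐ u ∂γ, ∀ i ∈ s, (c i • g i : Lp ℝ 2 γ) u = c i * u i := by
      refine (ae_ball_iff (S := (s : Set w)) s.countable_toSet).2 fun i _ => ?_
      filter_upwards [Lp.coeFn_smul (c i) (g i), (memLp_eval_stdGaussianFamily i).coeFn_toLp]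
        with u h1 h2
      rw [h1, Pi.smul_apply, h2, smul_eq_mul]
    filter_upwards [this] with u hu
    rw [Finset.sum_apply]
    exact Finset.sum_congr rfl hu
  change γ.map (W (∑ i ∈ s, c i • b i)) = gaussianReal 0 (‖∑ i ∈ s, c i • b i‖₊ ^ 2)
  rw [Measure.map_congr hWs]
  have hm (i : w) : Measurable fun u : w → ℝ => c i * u i := (measurable_pi_apply i).const_mul _
  have hp : IsProbabilityMeasure (γ.map fun u => ∑ i ∈ s, c i * u i) :=
    Measure.isProbabilityMeasure_map (Finset.measurable_fun_sum s fun i _ => hm i).aemeasurable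
  have hi : iIndepFun (fun (i : w) (u : w → ℝ) => c i * u i) γ :=
    iIndepFun_infinitePi (X := fun i x => c i * x) (fun i => by fun_prop)
  have hnorm : ‖∑ i ∈ s, c i • b i‖ ^ 2 = ∑ i ∈ s, c i ^ 2 := by
    rw [← real_inner_self_eq_norm_sq, b.orthonormal.inner_sum]
    simp [sq]
  refine Measure.ext_of_charFun (funext fun t => ?_)
  rw [(hi.restrict _).charFun_map_fun_finsetSum_eq_prod (fun i _ => (hm i).aemeasurable),
    charFun_gaussianReal]
  have hf (i : w) : charFun (γ.map fun u => c i * u i) t = Complex.exp (-(c i ^ 2 * t ^ 2 / 2)) := by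
    rw [charFun_map_mul_comp (measurable_pi_apply i).aemeasurable, Measure.infinitePi_map_eval, charFun_gaussianReal]
    congr 1
    push_cast
    simp
    ring
  simp_rw [Finset.prod_apply, hf, ← Complex.exp_sum]
  congr 1
  have : ((‖∑ i ∈ s, c i • b i‖₊ ^ 2 : ℝ≥0) : ℂ) = ∑ i ∈ s, (c i : ℂ) ^ 2 := by
    have := congrArg (Complex.ofReal) hnorm
    push_cast at this
    rw [← this]
    simp
  rw [this]
  simp [Finset.sum_mul, Finset.sum_div, Finset.sum_neg_distrib]

end Isonormal

/-! ### Gaussian processes with prescribed covariance, and the central limit theorem. -/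

section GaussianProcess

/-- For every family of vectors of a Hilbert space there is a centered Gaussian process whose
covariances are the inner products. -/
lemma exists_gaussianProcess {T H : Type*} [NormedAddCommGroup H] [InnerProductSpace ℝ H]
    [CompleteSpace H] (h : T → H) :
    ∃ (G : Measure (T → ℝ)) (_ : IsProbabilityMeasure G),
      (∀ (I : Finset T) (c : T → ℝ), G.map (fun u => ∑ p ∈ I, c p * u p) =
        gaussianReal 0 (‖∑ p ∈ I, c p • h p‖₊ ^ 2)) ∧
      (∀ p, ∫ u, u p ∂G = 0) ∧
      ∀ p q, cov[fun u => u p, fun u => u q; G] = inner ℝ (h p) (h q) := by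
  obtain ⟨w, W, hW⟩ := exists_isonormal (H := H)
  let γ := stdGaussianFamily w
  let F : (w → ℝ) → T → ℝ := fun u p => W (h p) u
  have hFp (p : T) : Measurable fun u => F u p := (Lp.stronglyMeasurable (W (h p))).measurable
  have hF : Measurable F := measurable_pi_lambda _ hFp
  have hmean (p : T) : ∫ u, u p ∂γ.map F = 0 := by
    rw [integral_map hF.aemeasurable (measurable_pi_apply p).aestronglyMeasurable]
    have := integral_map (μ := γ) (hFp p).aemeasurable (f := id) (by fun_prop)
    simp only [id] at this
    rw [← this]
    change ∫ y, y ∂((stdGaussianFamily w).map (W (h p))) = 0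
    rw [hW, integral_id_gaussianReal]
  refine ⟨γ.map F, Measure.isProbabilityMeasure_map hF.aemeasurable, fun I c => ?_, hmean,
    fun p q => ?_⟩
  · rw [Measure.map_map (Finset.measurable_fun_sum _ fun p _ => (measurable_pi_apply p).const_mul _)
      hF, ← hW]
    refine Measure.map_congr ?_
    simp only [map_sum, map_smul]
    refine EventuallyEq.trans ?_ (Lp.coeFn_finsetSum _ _).symm
    have : ∀ᵐ u ∂γ, ∀ p ∈ I, (c p • W (h p) : Lp ℝ 2 γ) u = c p * F u p := by
      refine (ae_ball_iff (S := (I : Set T)) I.countable_toSet).2 fun p _ => ?_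
      filter_upwards [Lp.coeFn_smul (c p) (W (h p))] with u h1
      rw [h1, Pi.smul_apply, smul_eq_mul]
    filter_upwards [this] with u hu
    rw [Finset.sum_apply]
    exact (Finset.sum_congr rfl hu).symm
  · rw [covariance, hmean, hmean, integral_map hF.aemeasurable]
    · rw [← W.inner_map_map, L2.inner_def]
      simp [F, mul_comm, γ]
    · exact (((measurable_pi_apply p).sub_const _).mul
        ((measurable_pi_apply q).sub_const _)).aestronglyMeasurable

lemma isGaussianProcess_of_map_sum {T : Type*} {G : Measure (T → ℝ)} {v : Finset T → (T → ℝ) → ℝ≥0}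
    (hG : ∀ (I : Finset T) (c : T → ℝ),
      G.map (fun u => ∑ p ∈ I, c p * u p) = gaussianReal 0 (v I c)) :
    IsGaussianProcess (fun (p : T) (u : T → ℝ) => u p) G := by
  classical
  refine ⟨fun I => ⟨isGaussian_of_map_eq_gaussianReal fun L => ?_⟩⟩
  -- The coefficients of the functional in the standard basis, extended by zero outside `I`.
  let c : T → ℝ := fun p => if hp : p ∈ I then L (Pi.single ⟨p, hp⟩ 1) else 0
  refine ⟨0, v I c, ?_⟩
  rw [Measure.map_map (by fun_prop) (by fun_prop), ← hG I c]
  congr 1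
  ext u
  have : (I.restrict fun p => u p) = ∑ p : I, u p.1 • (Pi.single p (1 : ℝ) : I → ℝ) := by
    ext q
    simp [Finset.sum_apply, Pi.single_apply]
  simp only [Function.comp_apply]
  rw [this, map_sum, ← Finset.sum_coe_sort I]
  refine Finset.sum_congr rfl fun p _ => ?_
  simp [c, mul_comm]

/-- Cramér–Wold device: it reduces convergence of vectors to convergence of their linear
combinations. -/
lemma charFun_map_euclideanSpace {Ω ι : Type*} [MeasurableSpace Ω] [Fintype ι] {Q : Measure Ω}
    {f : Ω → EuclideanSpace ℝ ι} (hf : AEMeasurable f Q) (t : EuclideanSpace ℝ ι) :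
    charFun (Q.map f) t = charFun (Q.map fun ω => ∑ i, t i * f ω i) 1 := by
  have hf' : AEMeasurable (fun ω => ∑ i, t i * f ω i) Q :=
    (show Measurable fun a : EuclideanSpace ℝ ι => ∑ i, t i * a i by fun_prop).comp_aemeasurable hf
  rw [charFun_apply, charFun_apply, integral_map hf (by fun_prop), integral_map hf' (by fun_prop)]
  simp [PiLp.inner_apply]

/-- A central limit theorem for the finite-dimensional distributions of normalized sums of
functions of independent, identically distributed variables. -/
theorem exists_gaussian_limit {T E : Type*} [MeasurableSpace E] (ρ : Measure E)
    [IsProbabilityMeasure ρ] (Ψ : T → E → ℝ) (hΨ : ∀ p, MemLp (Ψ p) 2 ρ)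
    (hΨ0 : ∀ p, ∫ y, Ψ p y ∂ρ = 0) :
    ∃ (G : Measure (T → ℝ)) (_ : IsProbabilityMeasure G),
      IsGaussianProcess (fun (p : T) (u : T → ℝ) => u p) G ∧ (∀ p, ∫ u, u p ∂G = 0) ∧
      (∀ p q, cov[fun u => u p, fun u => u q; G] = ∫ y, Ψ p y * Ψ q y ∂ρ) ∧
      ∀ {Ω : Type _} [MeasurableSpace Ω] (P : Measure Ω) [IsProbabilityMeasure P] (Y : ℕ → Ω → E),
        (∀ k, Measurable (Y k)) → (∀ k, P.map (Y k) = ρ) → iIndepFun Y P → ∀ I : Finset T,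
        TendstoInDistribution
          (fun (n : ℕ) (ω : Ω) (p : I) => (√n)⁻¹ * ∑ k ∈ Finset.range n, Ψ p.1 (Y k ω)) atTop
          (fun (u : T → ℝ) (p : I) => u p.1) (fun _ => P) G := by
  obtain ⟨G, hGp, hG, hG0, hGcov⟩ := exists_gaussianProcess fun p => (hΨ p).toLp
  refine ⟨G, hGp, isGaussianProcess_of_map_sum hG, hG0, fun p q => ?_, ?_⟩
  · rw [hGcov, L2.inner_def]
    refine integral_congr_ae ?_
    filter_upwards [(hΨ p).coeFn_toLp, (hΨ q).coeFn_toLp] with y h1 h2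
    simp [h1, h2, mul_comm]
  intro Ω _ P _ Y hYm hYl hYi I
  have hmp (k : ℕ) : MeasurePreserving (Y k) P ρ := ⟨hYm k, hYl k⟩
  have hae (p : T) (k : ℕ) : AEMeasurable (fun ω => Ψ p (Y k ω)) P :=
    ((hΨ p).1.comp_measurePreserving (hmp k)).aemeasurable
  have hsum (p : T) (n : ℕ) :
      AEMeasurable (fun ω => (√n)⁻¹ * ∑ k ∈ Finset.range n, Ψ p (Y k ω)) P :=
    (Finset.aemeasurable_fun_sum _ fun k _ => hae p k).const_mul _
  -- The criterion by characteristic functions needs an inner product, so the vectors are placed in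
  -- a Euclidean space and brought back by continuous mapping.
  suffices H : TendstoInDistribution (fun (n : ℕ) (ω : Ω) => WithLp.toLp 2 fun (p : I) =>
      (√n)⁻¹ * ∑ k ∈ Finset.range n, Ψ p.1 (Y k ω)) atTop
      (fun (u : T → ℝ) => WithLp.toLp 2 fun (p : I) => u p.1) (fun _ => P) G from
    H.continuous_comp (g := WithLp.ofLp) (PiLp.continuous_ofLp 2 _)
  have hm1 (n : ℕ) : AEMeasurable (fun (ω : Ω) => WithLp.toLp 2 fun (p : I) =>
      (√n)⁻¹ * ∑ k ∈ Finset.range n, Ψ p.1 (Y k ω)) P :=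
    (WithLp.measurable_toLp 2 _).comp_aemeasurable (aemeasurable_pi_lambda _ fun p => hsum p n)
  have hm2 : Measurable fun (u : T → ℝ) => WithLp.toLp 2 fun (p : I) => u p.1 :=
    (WithLp.measurable_toLp 2 _).comp (measurable_pi_lambda _ fun p => measurable_pi_apply p.1)
  refine ⟨hm1, hm2.aemeasurable, ProbabilityMeasure.tendsto_iff_tendsto_charFun.2 fun t => ?_⟩
  classical
  let c : T → ℝ := fun p => if hp : p ∈ I then t ⟨p, hp⟩ else 0
  let S : E → ℝ := fun y => ∑ p ∈ I, c p * Ψ p y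
  have hS : MemLp S 2 ρ := memLp_finsetSum _ fun p _ => (hΨ p).const_mul _
  have hS0 : ∫ y, S y ∂ρ = 0 := by
    rw [integral_finsetSum _ fun p _ => ((hΨ p).const_mul _).integrable (by norm_num)]
    simp [integral_const_mul, hΨ0]
  have hct (p : I) : t p = c p := by simp [c]
  have hSY (k : ℕ) : IdentDistrib (fun ω => S (Y k ω)) (fun ω => S (Y 0 ω)) P P := by
    have h0 (k : ℕ) : AEMeasurable S (P.map (Y k)) := by rw [hYl k]; exact hS.1.aemeasurable
    refine ⟨(h0 k).comp_measurable (hYm k), (h0 0).comp_measurable (hYm 0), ?_⟩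
    change P.map (S ∘ Y k) = P.map (S ∘ Y 0)
    rw [← AEMeasurable.map_map_of_aemeasurable (h0 k) (hYm k).aemeasurable,
      ← AEMeasurable.map_map_of_aemeasurable (h0 0) (hYm 0).aemeasurable, hYl, hYl]
  -- `S` is only almost everywhere measurable; independence is proved for a measurable modification
  -- and transferred.
  have hind : iIndepFun (fun k ω => S (Y k ω)) P := by
    refine (hYi.comp (fun _ => hS.1.aemeasurable.mk S) fun k => hS.1.aemeasurable.measurable_mk).congr
      fun k => ?_
    exact (hmp k).quasiMeasurePreserving.ae_eq_comp hS.1.aemeasurable.ae_eq_mk.symm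
  have hS2 : MemLp (fun ω => S (Y 0 ω)) 2 P := hS.comp_measurePreserving (hmp 0)
  have hSm : ∫ ω, S (Y 0 ω) ∂P = 0 := by
    rw [← hS0, ← hYl 0, integral_map (hYm 0).aemeasurable]
    rw [hYl 0]; exact hS.1
  -- The variance in the one-dimensional limit theorem is the squared Hilbert norm that defines the
  -- law of the same combination under `G`.
  have hvar : Var[fun ω => S (Y 0 ω); P] = ‖∑ p ∈ I, c p • (hΨ p).toLp‖ ^ 2 := by
    rw [variance_eq_integral hS2.1.aemeasurable, hSm, ← real_inner_self_eq_norm_sq, L2.inner_def]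
    have : (fun ω => (S (Y 0 ω) - 0) ^ 2) = (fun y => S y ^ 2) ∘ Y 0 := by ext; simp
    have h2 := integral_map (μ := P) (f := fun y => S y ^ 2) (hYm 0).aemeasurable
      (by rw [hYl 0]; exact hS.1.pow 2)
    rw [this, Function.comp_def, ← h2, hYl 0]
    refine integral_congr_ae ?_
    have h1 : (∑ p ∈ I, c p • (hΨ p).toLp : Lp ℝ 2 ρ) =ᵐ[ρ] S := by
      refine (Lp.coeFn_finsetSum _ _).trans ?_
      have : ∀ᵐ y ∂ρ, ∀ p ∈ I, (c p • (hΨ p).toLp : Lp ℝ 2 ρ) y = c p * Ψ p y := by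
        refine (ae_ball_iff (S := (I : Set T)) I.countable_toSet).2 fun p _ => ?_
        filter_upwards [Lp.coeFn_smul (c p) (hΨ p).toLp, (hΨ p).coeFn_toLp] with u h1 h2
        rw [h1, Pi.smul_apply, smul_eq_mul, h2]
      filter_upwards [this] with u hu
      rw [Finset.sum_apply]
      exact Finset.sum_congr rfl hu
    filter_upwards [h1] with y hy
    simp only [hy, RCLike.inner_apply, conj_trivial, sq]
  have hclt := tendstoInDistribution_inv_sqrt_mul_sum_sub (P := P) (X := fun k ω => S (Y k ω))
    (P' := gaussianReal 0 Var[fun ω => S (Y 0 ω); P].toNNReal) (Y := id)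
    ⟨aemeasurable_id, Measure.map_id⟩ hS2 hind hSY
  have hlim := ProbabilityMeasure.tendsto_iff_tendsto_charFun.1 hclt.tendsto 1
  have hG1 : charFun (G.map fun (u : T → ℝ) => WithLp.toLp 2 fun (p : I) => u p.1) t =
      charFun (gaussianReal 0 Var[fun ω => S (Y 0 ω); P].toNNReal) 1 := by
    rw [charFun_map_euclideanSpace hm2.aemeasurable, hvar]
    simp only [hct, Finset.univ_eq_attach]
    have h2 := hG I c
    simp only [← Finset.sum_attach I] at h2
    simp only [h2]
    congr 2
    ext
    simp [← Finset.sum_attach I]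
  simp only [ProbabilityMeasure.coe_mk, Measure.map_id] at hlim ⊢
  rw [hG1]
  refine hlim.congr fun n => ?_
  rw [charFun_map_euclideanSpace (hm1 n), hSm]
  simp only [hct, Finset.univ_eq_attach]
  congr 2
  ext ω
  simp only [mul_zero, sub_zero, S]
  rw [Finset.sum_comm, Finset.mul_sum, ← Finset.sum_attach I]
  refine Finset.sum_congr rfl fun p _ => ?_
  rw [← Finset.mul_sum]
  ring

end GaussianProcess

/-! ### First two moments of the Poisson distribution. -/

section PoissonMoments

lemma lintegral_poissonMeasure (r : ℝ≥0) (f : ℕ → ℝ≥0∞) :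
    ∫⁻ n, f n ∂poissonMeasure r =
      ∑' n : ℕ, f n * ENNReal.ofReal (Real.exp (-r) * r ^ n / n.factorial) := by
  rw [lintegral_countable']
  simp [poissonMeasure_singleton]

/-- The Chen–Stein identity, from `n / n! = 1 / (n - 1)!`. Taking `f = 1` and `f n = n` gives the
first two moments. -/
lemma lintegral_natCast_mul_poissonMeasure (r : ℝ≥0) (f : ℕ → ℝ≥0∞) :
    ∫⁻ n, n * f n ∂poissonMeasure r = r * ∫⁻ n, f (n + 1) ∂poissonMeasure r := by
  rw [lintegral_poissonMeasure, lintegral_poissonMeasure, tsum_eq_zero_add' ENNReal.summable,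
    ← ENNReal.tsum_mul_left]
  simp only [Nat.cast_zero, zero_mul, zero_add]
  refine tsum_congr fun n => ?_
  have h : ((n + 1 : ℕ) : ℝ≥0∞) * ENNReal.ofReal (Real.exp (-r) * r ^ (n + 1) / (n + 1).factorial) =
      r * ENNReal.ofReal (Real.exp (-r) * r ^ n / n.factorial) := by
    rw [← ENNReal.ofReal_natCast, ← ENNReal.ofReal_coe_nnreal,
      ← ENNReal.ofReal_mul (by positivity), ← ENNReal.ofReal_mul (by positivity)]
    congr 1
    rw [Nat.factorial_succ]
    push_cast
    field_simp
    ring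
  rw [mul_right_comm, h]
  ring

lemma lintegral_natCast_poissonMeasure (r : ℝ≥0) : ∫⁻ n, (n : ℝ≥0∞) ∂poissonMeasure r = r := by
  simpa using lintegral_natCast_mul_poissonMeasure r 1

lemma lintegral_natCast_mul_self_poissonMeasure (r : ℝ≥0) :
    ∫⁻ n, (n : ℝ≥0∞) * n ∂poissonMeasure r = r + r * r := by
  rw [lintegral_natCast_mul_poissonMeasure]
  simp only [Nat.cast_add, Nat.cast_one]
  rw [lintegral_add_right _ (by fun_prop), lintegral_natCast_poissonMeasure]
  simp
  ring

end PoissonMoments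

/-! ### Moment formulas for nonnegative Poisson integrals. -/

namespace IsPoissonRandomMeasure

variable {Ω E : Type*} [MeasurableSpace Ω] [MeasurableSpace E] {M : Ω → Measure E} {μ : Measure E}
  {P : Measure Ω}

lemma measurable_apply (h : IsPoissonRandomMeasure M μ P) {A : Set E} (hA : MeasurableSet A) :
    Measurable fun ω => M ω A :=
  (Measure.measurable_coe hA).comp h.measurable

/-- The number of points of a set is almost surely `0` or at least `1`. -/
lemma ae_eq_zero_or_one_le (h : IsPoissonRandomMeasure M μ P) {A : Set E} (hA : MeasurableSet A) :
    ∀ᵐ ω ∂P, M ω A = 0 ∨ 1 ≤ M ω A := by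
  by_cases hμ : μ A = ∞
  · filter_upwards [h.infinite A hA hμ] with ω hω
    simp [hω]
  have hs : MeasurableSet {x : ℝ≥0∞ | x = 0 ∨ 1 ≤ x} :=
    (measurableSet_singleton 0).union measurableSet_Ici
  have h1 : ∀ᵐ x ∂P.map (fun ω => M ω A), x = 0 ∨ 1 ≤ x := by
    rw [h.poisson A hA hμ]
    refine (ae_map_iff (by fun_prop) hs).2 (Eventually.of_forall fun n => ?_)
    rcases n.eq_zero_or_pos with rfl | hn
    · simp
    · exact Or.inr (by exact_mod_cast hn)
  exact (ae_map_iff (h.measurable_apply hA).aemeasurable hs).1 h1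

variable [IsProbabilityMeasure P]

lemma lintegral_apply (h : IsPoissonRandomMeasure M μ P) {A : Set E} (hA : MeasurableSet A) :
    ∫⁻ ω, M ω A ∂P = μ A := by
  by_cases hμ : μ A = ∞
  · rw [lintegral_congr_ae (h.infinite A hA hμ), hμ]
    simp
  have := lintegral_map (μ := P) measurable_id (h.measurable_apply hA)
  simp only [id] at this
  rw [← this, h.poisson A hA hμ, lintegral_map (f := fun x => x) measurable_id (by fun_prop)]
  simp [lintegral_natCast_poissonMeasure, hμ]

lemma lintegral_apply_mul_self (h : IsPoissonRandomMeasure M μ P) {A : Set E}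
    (hA : MeasurableSet A) : ∫⁻ ω, M ω A * M ω A ∂P = μ A + μ A * μ A := by
  by_cases hμ : μ A = ∞
  · rw [lintegral_congr_ae ((h.infinite A hA hμ).mono fun ω hω => by
      rw [hω] : _ =ᵐ[P] fun _ => ∞ * ∞), hμ]
    simp
  have := lintegral_map (μ := P) (f := fun x : ℝ≥0∞ => x * x) (by fun_prop) (h.measurable_apply hA)
  rw [← this, h.poisson A hA hμ, lintegral_map (by fun_prop) (by fun_prop),
    lintegral_natCast_mul_self_poissonMeasure]
  simp [hμ]

lemma lintegral_apply_mul_of_disjoint (h : IsPoissonRandomMeasure M μ P) {A B : Set E}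
    (hA : MeasurableSet A) (hB : MeasurableSet B) (hAB : Disjoint A B) :
    ∫⁻ ω, M ω A * M ω B ∂P = μ A * μ B := by
  have hi := h.indep 2 ![A, B] (by simp [Fin.forall_fin_two, hA, hB])
    (by
      intro i j hij
      fin_cases i <;> fin_cases j <;> simp_all [hAB.symm])
  have := hi.indepFun (show (0 : Fin 2) ≠ 1 by simp)
  rw [← h.lintegral_apply hA, ← h.lintegral_apply hB]
  exact lintegral_mul_eq_lintegral_mul_lintegral_of_indepFun (h.measurable_apply hA)
    (h.measurable_apply hB) this

/-- Both sets are split along `A ∩ B`. Disjoint pieces are independent, and the square of the common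
piece contributes the extra `μ (A ∩ B)`. -/
lemma lintegral_apply_mul_apply (h : IsPoissonRandomMeasure M μ P) {A B : Set E}
    (hA : MeasurableSet A) (hB : MeasurableSet B) :
    ∫⁻ ω, M ω A * M ω B ∂P = μ (A ∩ B) + μ A * μ B := by
  have hAB := hA.inter hB
  have e1 (m : Measure E) : m A = m (A ∩ B) + m (A \ B) := (measure_inter_add_sdiff A hB).symm
  have e2 (m : Measure E) : m B = m (A ∩ B) + m (B \ A) := by
    rw [inter_comm]; exact (measure_inter_add_sdiff B hA).symm
  have m0 := h.measurable_apply hAB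
  have m1 := h.measurable_apply (hA.diff hB)
  have m2 := h.measurable_apply (hB.diff hA)
  have : ∀ ω, M ω A * M ω B = M ω (A ∩ B) * M ω (A ∩ B) + M ω (A ∩ B) * M ω (B \ A) +
      (M ω (A \ B) * M ω (A ∩ B) + M ω (A \ B) * M ω (B \ A)) := fun ω => by
    rw [e1 (M ω), e2 (M ω)]; ring
  simp_rw [this]
  rw [lintegral_add_left (by fun_prop), lintegral_add_left (by fun_prop),
    lintegral_add_left (by fun_prop), h.lintegral_apply_mul_self hAB,
    h.lintegral_apply_mul_of_disjoint hAB (hB.diff hA)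
      (disjoint_sdiff_right.mono_left inter_subset_left),
    h.lintegral_apply_mul_of_disjoint (hA.diff hB) hAB
      (disjoint_sdiff_left.mono_right inter_subset_right),
    h.lintegral_apply_mul_of_disjoint (hA.diff hB) (hB.diff hA)
      (disjoint_sdiff_left.mono_right sdiff_subset), e1 μ, e2 μ]
  ring

/-- Campbell's formula. -/
lemma lintegral_lintegral (h : IsPoissonRandomMeasure M μ P) {f : E → ℝ≥0∞} (hf : Measurable f) :
    ∫⁻ ω, ∫⁻ a, f a ∂M ω ∂P = ∫⁻ a, f a ∂μ := by
  have hj : (P.map M).join = μ := by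
    ext A hA
    rw [Measure.join_apply hA, lintegral_map (Measure.measurable_coe hA) h.measurable,
      h.lintegral_apply hA]
  rw [← hj, Measure.lintegral_join hf.aemeasurable,
    lintegral_map (Measure.measurable_lintegral hf) h.measurable]

omit [IsProbabilityMeasure P] in
lemma measurable_lintegral (h : IsPoissonRandomMeasure M μ P) {f : E → ℝ≥0∞} (hf : Measurable f) :
    Measurable fun ω => ∫⁻ a, f a ∂M ω :=
  (Measure.measurable_lintegral hf).comp h.measurable

/-- The identity for sets is extended to functions one factor at a time. Weighting `P` by `M B`
turns the mixed moment into a mean measure, which is identified on sets and then integrated against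
`f`. -/
lemma lintegral_lintegral_mul_apply (h : IsPoissonRandomMeasure M μ P) {f : E → ℝ≥0∞}
    (hf : Measurable f) {B : Set E} (hB : MeasurableSet B) :
    ∫⁻ ω, (∫⁻ a, f a ∂M ω) * M ω B ∂P = ∫⁻ a in B, f a ∂μ + (∫⁻ a, f a ∂μ) * μ B := by
  have hMB := h.measurable_apply hB
  have hj : ((P.withDensity fun ω => M ω B).map M).join = μ.restrict B + μ B • μ := by
    ext A hA
    rw [Measure.join_apply hA, lintegral_map (Measure.measurable_coe hA) h.measurable,
      lintegral_withDensity_eq_lintegral_mul _ hMB (h.measurable_apply hA)]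
    simp only [Pi.mul_apply]
    rw [h.lintegral_apply_mul_apply hB hA]
    simp [Measure.restrict_apply hA, inter_comm]
  have := Measure.lintegral_join (m := (P.withDensity fun ω => M ω B).map M) hf.aemeasurable
  rw [hj, lintegral_map (Measure.measurable_lintegral hf) h.measurable,
    lintegral_withDensity_eq_lintegral_mul _ hMB (h.measurable_lintegral hf),
    lintegral_add_measure, lintegral_smul_measure] at this
  simp only [Pi.mul_apply, smul_eq_mul] at this
  rw [mul_comm _ (μ B), this]
  simp_rw [mul_comm]

/-- The mixed second moment of two integrals of nonnegative functions. -/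
lemma lintegral_lintegral_mul_lintegral (h : IsPoissonRandomMeasure M μ P) {f g : E → ℝ≥0∞}
    (hf : Measurable f) (hg : Measurable g) :
    ∫⁻ ω, (∫⁻ a, f a ∂M ω) * (∫⁻ a, g a ∂M ω) ∂P =
      ∫⁻ a, f a * g a ∂μ + (∫⁻ a, f a ∂μ) * ∫⁻ a, g a ∂μ := by
  have hMf := h.measurable_lintegral hf
  -- The same argument for the other factor, with `∫ f dM` as the weight.
  have hj : ((P.withDensity fun ω => ∫⁻ a, f a ∂M ω).map M).join =
      μ.withDensity f + (∫⁻ a, f a ∂μ) • μ := by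
    ext A hA
    rw [Measure.join_apply hA, lintegral_map (Measure.measurable_coe hA) h.measurable,
      lintegral_withDensity_eq_lintegral_mul _ hMf (h.measurable_apply hA)]
    simp only [Pi.mul_apply]
    rw [h.lintegral_lintegral_mul_apply hf hA]
    simp [withDensity_apply _ hA]
  have := Measure.lintegral_join (m := (P.withDensity fun ω => ∫⁻ a, f a ∂M ω).map M)
    hg.aemeasurable
  rw [hj, lintegral_map (Measure.measurable_lintegral hg) h.measurable,
    lintegral_withDensity_eq_lintegral_mul _ hMf (h.measurable_lintegral hg),
    lintegral_add_measure, lintegral_smul_measure,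
    lintegral_withDensity_eq_lintegral_mul _ hf hg] at this
  simp only [Pi.mul_apply, smul_eq_mul] at this
  exact this.symm

omit [IsProbabilityMeasure P] in
/-- The integral against a Poisson random measure is, up to truncation, subadditive. -/
lemma ae_min_lintegral_le (h : IsPoissonRandomMeasure M μ P) {f : E → ℝ≥0∞} (hf : Measurable f)
    (K : ℝ≥0∞) : ∀ᵐ ω ∂P, min (∫⁻ a, f a ∂M ω) K ≤ ∫⁻ a, min (f a) K ∂M ω := by
  have hA : MeasurableSet {a | K ≤ f a} := measurableSet_le measurable_const hf
  filter_upwards [h.ae_eq_zero_or_one_le hA] with ω hω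
  -- Either no mass sits where `f ≥ K`, and truncation changes nothing, or mass at least one does,
  -- and it already contributes `K`.
  rcases hω with h0 | h1
  · refine (min_le_left _ _).trans (lintegral_mono_ae ?_)
    rw [← compl_mem_ae_iff] at h0
    filter_upwards [h0] with a ha
    simp only [mem_compl_iff, mem_ofPred_eq, not_le] at ha
    rw [min_eq_left ha.le]
  · refine (min_le_right _ _).trans ?_
    calc K ≤ K * M ω {a | K ≤ f a} := le_mul_of_one_le_right' h1
      _ = ∫⁻ a in {a | K ≤ f a}, K ∂M ω := by simp
      _ ≤ ∫⁻ a in {a | K ≤ f a}, min (f a) K ∂M ω :=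
        setLIntegral_mono (by fun_prop) fun a ha => le_min ha le_rfl
      _ ≤ _ := setLIntegral_le_lintegral _ _

end IsPoissonRandomMeasure

/-! ### Uniqueness of the law of a Poisson random measure. -/

section Law

variable {Ω Ω' E : Type*} [MeasurableSpace Ω] [MeasurableSpace Ω'] [MeasurableSpace E]
  {M : Ω → Measure E} {M' : Ω' → Measure E} {μ : Measure E} {P : Measure Ω} {P' : Measure Ω'}

lemma IsPoissonRandomMeasure.map_apply_eq [IsProbabilityMeasure P] [IsProbabilityMeasure P']
    (h : IsPoissonRandomMeasure M μ P) (h' : IsPoissonRandomMeasure M' μ P') {A : Set E}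
    (hA : MeasurableSet A) : P.map (fun ω => M ω A) = P'.map (fun ω => M' ω A) := by
  by_cases hμ : μ A = ∞
  · rw [Measure.map_congr (h.infinite A hA hμ), Measure.map_congr (h'.infinite A hA hμ)]
    simp
  · rw [h.poisson A hA hμ, h'.poisson A hA hμ]

lemma IsPoissonRandomMeasure.map_pi_eq [IsProbabilityMeasure P] [IsProbabilityMeasure P']
    (h : IsPoissonRandomMeasure M μ P) (h' : IsPoissonRandomMeasure M' μ P') {n : ℕ}
    {A : Fin n → Set E} (hA : ∀ i, MeasurableSet (A i))
    (hd : Pairwise fun i j => Disjoint (A i) (A j)) :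
    P.map (fun ω i => M ω (A i)) = P'.map (fun ω i => M' ω (A i)) := by
  rw [(h.indep n A hA hd).map_fun_eq_pi_map fun i => (h.measurable_apply (hA i)).aemeasurable,
    (h'.indep n A hA hd).map_fun_eq_pi_map fun i => (h'.measurable_apply (hA i)).aemeasurable]
  simp_rw [h.map_apply_eq h' (hA _)]

/-- The law of a Poisson random measure is determined by its mean measure. -/
theorem IsPoissonRandomMeasure.map_eq [IsProbabilityMeasure P] [IsProbabilityMeasure P']
    (h : IsPoissonRandomMeasure M μ P) (h' : IsPoissonRandomMeasure M' μ P') :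
    P.map M = P'.map M' := by
  classical
  let T := {A : Set E // MeasurableSet A}
  let ev : Measure E → T → ℝ≥0∞ := fun m A => m A.1
  have hev : Measurable ev := measurable_pi_lambda _ fun A => Measure.measurable_coe A.2
  -- The sigma-field on measures is generated by the evaluations, so it suffices to compare
  -- finite-dimensional distributions.
  have hcomap : (inferInstance : MeasurableSpace (Measure E)) = MeasurableSpace.comap ev inferInstance := by
    refine le_antisymm (iSup₂_le fun s hs => ?_) hev.comap_le
    rw [MeasurableSpace.comap_le_iff_le_map]
    have h1 : Measurable[MeasurableSpace.comap ev inferInstance] fun m : Measure E => m s :=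
      (measurable_pi_apply (⟨s, hs⟩ : T)).comp (comap_measurable ev)
    intro B hB
    exact h1 hB
  have key : (P.map M).map ev = (P'.map M').map ev := by
    refine IsProjectiveLimit.unique (P := fun I : Finset T => ((P'.map M').map ev).map I.restrict)
      ?_ fun I => rfl
    intro I
    have hI : Measurable (I.restrict (π := fun _ : T => ℝ≥0∞)) := by fun_prop
    change ((P.map M).map ev).map I.restrict = ((P'.map M').map ev).map I.restrict
    rw [Measure.map_map hI hev, Measure.map_map hI hev,
      Measure.map_map (hI.comp hev) h.measurable, Measure.map_map (hI.comp hev) h'.measurable]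
    let e := Fintype.equivFin (I → Bool)
    -- The atoms of the algebra generated by the finitely many sets in `I`. They are disjoint, so
    -- the joint law of their masses is known, and each set of `I` is a union of atoms.
    let at' : Fin (Fintype.card (I → Bool)) → Set E :=
      fun j => ⋂ A : I, if e.symm j A then A.1.1 else A.1.1ᶜ
    have hat (j) : MeasurableSet (at' j) := by
      refine MeasurableSet.iInter fun A => ?_
      split_ifs
      exacts [A.1.2, A.1.2.compl]
    have mem_at (j) (x : E) : x ∈ at' j ↔ ∀ A : I, (e.symm j A = true ↔ x ∈ A.1.1) := by
      simp only [at', mem_iInter]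
      refine forall_congr' fun A => ?_
      split_ifs with hc <;> simp [hc]
    have hdisj : Pairwise fun i j => Disjoint (at' i) (at' j) := by
      intro i j hij
      refine Set.disjoint_left.2 fun x hi hj => hij (e.symm.injective (funext fun A => ?_))
      have h1 := (mem_at i x).1 hi A
      have h2 := (mem_at j x).1 hj A
      exact Bool.eq_iff_iff.2 (h1.trans h2.symm)
    have hsum (m : Measure E) (A : I) :
        m A.1.1 = ∑ j ∈ Finset.univ.filter (fun j => e.symm j A = true), m (at' j) := by
      rw [← measure_biUnion_finset (fun i _ j _ hij => hdisj hij) fun j _ => hat j]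
      congr 1
      ext x
      simp only [Finset.mem_filter, Finset.mem_univ, true_and, mem_iUnion, exists_prop]
      constructor
      · intro hx
        refine ⟨e fun B => decide (x ∈ B.1.1), by simpa using hx, (mem_at _ _).2 fun B => ?_⟩
        simp
      · rintro ⟨j, hj, hx⟩
        exact ((mem_at j x).1 hx A).1 hj
    let Lin : (Fin (Fintype.card (I → Bool)) → ℝ≥0∞) → I → ℝ≥0∞ :=
      fun v A => ∑ j ∈ Finset.univ.filter (fun j => e.symm j A = true), v j
    have hLin : Measurable Lin := measurable_pi_lambda _ fun A => by fun_prop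
    have e1 : (I.restrict ∘ ev) ∘ M = Lin ∘ fun ω j => M ω (at' j) := by
      ext ω A
      exact hsum (M ω) A
    have e2 : (I.restrict ∘ ev) ∘ M' = Lin ∘ fun ω j => M' ω (at' j) := by
      ext ω A
      exact hsum (M' ω) A
    rw [e1, e2, ← Measure.map_map hLin (measurable_pi_lambda _ fun j => h.measurable_apply (hat j)),
      ← Measure.map_map hLin (measurable_pi_lambda _ fun j => h'.measurable_apply (hat j)),
      h.map_pi_eq h' hat hdisj]
  ext B hB
  have hB' : MeasurableSet[MeasurableSpace.comap ev inferInstance] B := hcomap ▸ hB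
  obtain ⟨C, hC, rfl⟩ := hB'
  rw [← Measure.map_apply hev hC, ← Measure.map_apply hev hC, key]

end Law

/-! ### Random measures as an s-finite kernel. -/

section Kernel

variable {Ω E : Type*} [MeasurableSpace Ω] [MeasurableSpace E]

/-- The restriction of a measure to a set, made a finite kernel by normalization. -/
def normalizedRestrict (D : Set E) (hD : MeasurableSet D) : Kernel (Measure E) E where
  toFun m := (m D)⁻¹ • m.restrict D
  measurable' := by
    refine Measure.measurable_of_measurable_coe _ fun A hA => ?_
    simp only [Measure.smul_apply, Measure.restrict_apply hA, smul_eq_mul]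
    exact (Measure.measurable_coe hD).inv.mul (Measure.measurable_coe (hA.inter hD))

instance (D : Set E) (hD : MeasurableSet D) : IsFiniteKernel (normalizedRestrict D hD) :=
  ⟨⟨1, ENNReal.one_lt_top, fun m => by
    change ((m D)⁻¹ • m.restrict D) univ ≤ 1
    -- The total mass `(m D)⁻¹ * m D` is at most one, also when `m D` is `0` or `∞`.
    simp [ENNReal.inv_mul_le_one]⟩⟩

/-- An s-finite kernel which maps a measure to its restriction to `D` if this is finite. -/
def restrictKernel (D : Set E) (hD : MeasurableSet D) : Kernel (Measure E) E :=
  Kernel.withDensity (normalizedRestrict D hD) fun m _ => (m D).toNNReal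

instance (D : Set E) (hD : MeasurableSet D) : IsSFiniteKernel (restrictKernel D hD) := by
  unfold restrictKernel; infer_instance

lemma restrictKernel_apply {D : Set E} (hD : MeasurableSet D) {m : Measure E} (hm : m D ≠ ∞) :
    restrictKernel D hD m = m.restrict D := by
  have h1 : Measurable (Function.uncurry fun (m : Measure E) (_ : E) => ((m D).toNNReal : ℝ≥0∞)) :=
    ((Measure.measurable_coe hD).ennreal_toNNReal.coe_nnreal_ennreal).comp measurable_fst
  rw [restrictKernel, Kernel.withDensity_apply _ h1, withDensity_const, ENNReal.coe_toNNReal hm]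
  change m D • ((m D)⁻¹ • m.restrict D) = _
  by_cases h0 : m D = 0
  · rw [Measure.restrict_eq_zero.2 h0]; simp
  · rw [smul_smul, ENNReal.mul_inv_cancel h0 hm, one_smul]

/-- An s-finite kernel which coincides with the identity on measures which are finite on the
spanning sets of `μ`. -/
def idKernel (μ : Measure E) [SigmaFinite μ] : Kernel (Measure E) E :=
  Kernel.sum fun n => restrictKernel (disjointed (spanningSets μ) n)
    (MeasurableSet.disjointed (measurableSet_spanningSets μ) n)

instance (μ : Measure E) [SigmaFinite μ] : IsSFiniteKernel (idKernel μ) := by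
  unfold idKernel; infer_instance

/-- Each spanning set has finite mean mass, hence almost surely finite mass. Replacing `M ω` by
`idKernel μ (M ω)` makes integrals of `F x` against `m` jointly measurable in `(x, m)`. -/
lemma IsPoissonRandomMeasure.ae_idKernel_eq {M : Ω → Measure E} {μ : Measure E} {P : Measure Ω}
    [SigmaFinite μ] [IsProbabilityMeasure P] (h : IsPoissonRandomMeasure M μ P) :
    ∀ᵐ ω ∂P, idKernel μ (M ω) = M ω := by
  have hm (n : ℕ) := MeasurableSet.disjointed (measurableSet_spanningSets μ) n
  have h1 : ∀ᵐ ω ∂P, ∀ n, M ω (disjointed (spanningSets μ) n) < ∞ := by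
    refine ae_all_iff.2 fun n => ae_lt_top (h.measurable_apply (hm n)) ?_
    rw [h.lintegral_apply (hm n)]
    exact ((measure_mono (disjointed_subset _ n)).trans_lt (measure_spanningSets_lt_top μ n)).ne
  filter_upwards [h1] with ω hω
  rw [idKernel, Kernel.sum_apply]
  simp_rw [restrictKernel_apply (hm _) (hω _).ne]
  rw [← Measure.restrict_iUnion (disjoint_disjointed _) hm, iUnion_disjointed,
    iUnion_spanningSets, Measure.restrict_univ]

end Kernel

/-! ### Moment formulas for real Poisson integrals. -/

section RealIntegrals

variable {Ω E : Type*} [MeasurableSpace Ω] [MeasurableSpace E] {M : Ω → Measure E} {μ : Measure E}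
  {P : Measure Ω} [IsProbabilityMeasure P] {f g : E → ℝ}

omit [IsProbabilityMeasure P] in
lemma integral_sub_mul_sub {a a' b b' : Ω → ℝ} (ha : MemLp a 2 P) (ha' : MemLp a' 2 P)
    (hb : MemLp b 2 P) (hb' : MemLp b' 2 P) :
    ∫ ω, (a ω - a' ω) * (b ω - b' ω) ∂P =
      (∫ ω, a ω * b ω ∂P - ∫ ω, a ω * b' ω ∂P) - (∫ ω, a' ω * b ω ∂P - ∫ ω, a' ω * b' ω ∂P) := by
  have h1 : Integrable (fun ω => a ω * b ω) P := ha.integrable_mul hb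
  have h2 : Integrable (fun ω => a ω * b' ω) P := ha.integrable_mul hb'
  have h3 : Integrable (fun ω => a' ω * b ω) P := ha'.integrable_mul hb
  have h4 : Integrable (fun ω => a' ω * b' ω) P := ha'.integrable_mul hb'
  rw [← integral_sub h1 h2, ← integral_sub h3 h4]
  refine Eq.trans ?_ (integral_sub (h1.sub h2) (h3.sub h4))
  congr 1
  ext ω
  ring

lemma integral_eq_pos_sub_neg {μ : Measure E} (hfi : Integrable f μ) :
    ∫ a, f a ∂μ = (∫ a, max (f a) 0 ∂μ) - ∫ a, max (-f a) 0 ∂μ := by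
  rw [← integral_sub hfi.pos_part hfi.neg_part]
  congr 1
  ext a
  rw [max_zero_sub_max_neg_zero_eq_self]

namespace IsPoissonRandomMeasure

lemma ae_integrable (h : IsPoissonRandomMeasure M μ P) (hf : Measurable f) (hfi : Integrable f μ) :
    ∀ᵐ ω ∂P, Integrable f (M ω) := by
  have := ae_lt_top (μ := P) (h.measurable_lintegral hf.enorm)
    (by rw [h.lintegral_lintegral hf.enorm]; exact hfi.2.ne)
  filter_upwards [this] with ω hω
  exact ⟨hf.aestronglyMeasurable, hω⟩

omit [IsProbabilityMeasure P] in
lemma stronglyMeasurable_integral (h : IsPoissonRandomMeasure M μ P) (hf : Measurable f) :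
    StronglyMeasurable fun ω => ∫ a, f a ∂M ω :=
  StronglyMeasurable.integral_kernel (κ := ⟨M, h.measurable⟩) hf.stronglyMeasurable

lemma lintegral_sq_lt_top (hf2 : MemLp f 2 μ) : ∫⁻ a, ‖f a‖ₑ * ‖f a‖ₑ ∂μ < ∞ := by
  have := hf2.2
  rw [eLpNorm_lt_top_iff_lintegral_rpow_enorm_lt_top (by simp) (by simp)] at this
  simpa [sq] using this

lemma memLp_integral (h : IsPoissonRandomMeasure M μ P) (hf : Measurable f)
    (hfi : Integrable f μ) (hf2 : MemLp f 2 μ) : MemLp (fun ω => ∫ a, f a ∂M ω) 2 P := by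
  refine ⟨(h.stronglyMeasurable_integral hf).aestronglyMeasurable, ?_⟩
  rw [eLpNorm_lt_top_iff_lintegral_rpow_enorm_lt_top (by simp) (by simp)]
  simp only [ENNReal.toReal_ofNat, ENNReal.rpow_ofNat, sq]
  calc ∫⁻ ω, ‖∫ a, f a ∂M ω‖ₑ * ‖∫ a, f a ∂M ω‖ₑ ∂P
      ≤ ∫⁻ ω, (∫⁻ a, ‖f a‖ₑ ∂M ω) * (∫⁻ a, ‖f a‖ₑ ∂M ω) ∂P :=
        lintegral_mono fun ω => mul_le_mul' (enorm_integral_le_lintegral_enorm _)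
          (enorm_integral_le_lintegral_enorm _)
    _ < ∞ := by
        rw [h.lintegral_lintegral_mul_lintegral hf.enorm hf.enorm]
        exact ENNReal.add_lt_top.2 ⟨lintegral_sq_lt_top hf2, ENNReal.mul_lt_top hfi.2 hfi.2⟩

lemma integral_integral (h : IsPoissonRandomMeasure M μ P) (hf : Measurable f)
    (hfi : Integrable f μ) : ∫ ω, ∫ a, f a ∂M ω ∂P = ∫ a, f a ∂μ := by
  have key {g : E → ℝ} (hg : Measurable g) (hg0 : ∀ a, 0 ≤ g a) (hgi : Integrable g μ) :
      Integrable (fun ω => ∫ a, g a ∂M ω) P ∧ ∫ ω, ∫ a, g a ∂M ω ∂P = ∫ a, g a ∂μ := by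
    have e (m : Measure E) : ∫ a, g a ∂m = (∫⁻ a, ENNReal.ofReal (g a) ∂m).toReal :=
      integral_eq_lintegral_of_nonneg_ae (Eventually.of_forall hg0) hg.aestronglyMeasurable
    have hm := h.measurable_lintegral hg.ennreal_ofReal
    have hfin : ∫⁻ ω, ∫⁻ a, ENNReal.ofReal (g a) ∂M ω ∂P ≠ ∞ := by
      rw [h.lintegral_lintegral hg.ennreal_ofReal]
      exact hgi.lintegral_lt_top.ne
    simp_rw [e]
    refine ⟨integrable_toReal_of_lintegral_ne_top hm.aemeasurable hfin, ?_⟩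
    rw [integral_toReal hm.aemeasurable (ae_lt_top hm hfin), h.lintegral_lintegral hg.ennreal_ofReal]
  have hp := key (hf.max measurable_const) (fun a => le_max_right (f a) 0) hfi.pos_part
  have hn := key (g := fun a => max (-f a) 0) (hf.neg.max measurable_const)
    (fun a => le_max_right _ 0) hfi.neg_part
  have e : ∀ᵐ ω ∂P, ∫ a, f a ∂M ω = (∫ a, max (f a) 0 ∂M ω) - ∫ a, max (-f a) 0 ∂M ω := by
    filter_upwards [h.ae_integrable hf hfi] with ω hω using integral_eq_pos_sub_neg hω
  rw [integral_congr_ae e, integral_sub hp.1 hn.1, hp.2, hn.2, integral_eq_pos_sub_neg hfi]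

lemma integral_integral_mul_integral_of_nonneg (h : IsPoissonRandomMeasure M μ P)
    (hf : Measurable f) (hg : Measurable g) (hf0 : ∀ a, 0 ≤ f a) (hg0 : ∀ a, 0 ≤ g a)
    (hfi : Integrable f μ) (hgi : Integrable g μ) (hfg : Integrable (fun a => f a * g a) μ) :
    ∫ ω, (∫ a, f a ∂M ω) * (∫ a, g a ∂M ω) ∂P =
      ∫ a, f a * g a ∂μ + (∫ a, f a ∂μ) * ∫ a, g a ∂μ := by
  have e {g : E → ℝ} (hg : Measurable g) (hg0 : ∀ a, 0 ≤ g a) (m : Measure E) :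
      ∫ a, g a ∂m = (∫⁻ a, ENNReal.ofReal (g a) ∂m).toReal :=
    integral_eq_lintegral_of_nonneg_ae (Eventually.of_forall hg0) hg.aestronglyMeasurable
  have hmf := h.measurable_lintegral hf.ennreal_ofReal
  have hmg := h.measurable_lintegral hg.ennreal_ofReal
  have hfg' : ∀ a, ENNReal.ofReal (f a * g a) = ENNReal.ofReal (f a) * ENNReal.ofReal (g a) :=
    fun a => ENNReal.ofReal_mul (hf0 a)
  have e2 := h.lintegral_lintegral_mul_lintegral hf.ennreal_ofReal hg.ennreal_ofReal
  have hfin : ∫⁻ a, ENNReal.ofReal (f a) * ENNReal.ofReal (g a) ∂μ ≠ ∞ := by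
    simp_rw [← hfg']
    exact hfg.lintegral_lt_top.ne
  have hfin2 : (∫⁻ a, ENNReal.ofReal (f a) ∂μ) * ∫⁻ a, ENNReal.ofReal (g a) ∂μ ≠ ∞ :=
    (ENNReal.mul_lt_top hfi.lintegral_lt_top hgi.lintegral_lt_top).ne
  rw [e (g := fun a => f a * g a) (hf.mul hg) (fun a => mul_nonneg (hf0 a) (hg0 a)) μ,
    e hf hf0 μ, e hg hg0 μ]
  simp_rw [hfg', e hf hf0 (M _), e hg hg0 (M _), ← ENNReal.toReal_mul]
  rw [← ENNReal.toReal_add hfin hfin2, ← e2]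
  refine integral_toReal (hmf.mul hmg).aemeasurable (ae_lt_top (hmf.mul hmg) ?_)
  rw [e2]
  exact ENNReal.add_ne_top.2 ⟨hfin, hfin2⟩

/-- The mixed second moment of two integrals. -/
theorem integral_integral_mul_integral (h : IsPoissonRandomMeasure M μ P)
    (hf : Measurable f) (hg : Measurable g) (hfi : Integrable f μ) (hgi : Integrable g μ)
    (hf2 : MemLp f 2 μ) (hg2 : MemLp g 2 μ) :
    ∫ ω, (∫ a, f a ∂M ω) * (∫ a, g a ∂M ω) ∂P =
      ∫ a, f a * g a ∂μ + (∫ a, f a ∂μ) * ∫ a, g a ∂μ := by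
  have pos {f : E → ℝ} (hf : Measurable f) (hfi : Integrable f μ) (hf2 : MemLp f 2 μ) :
      Measurable (fun a => max (f a) 0) ∧ (∀ a, 0 ≤ max (f a) 0) ∧
      Integrable (fun a => max (f a) 0) μ ∧ MemLp (fun a => max (f a) 0) 2 μ ∧
      MemLp (fun ω => ∫ a, max (f a) 0 ∂M ω) 2 P := by
    have hm : Measurable (fun a => max (f a) 0) := hf.max measurable_const
    have h2 : MemLp (fun a => max (f a) 0) 2 μ := hf2.mono hm.aestronglyMeasurable
      (Eventually.of_forall fun a => by
        rw [Real.norm_of_nonneg (le_max_right _ _)]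
        exact max_le (le_abs_self _) (abs_nonneg _))
    exact ⟨hm, fun a => le_max_right _ _, hfi.pos_part, h2, h.memLp_integral hm hfi.pos_part h2⟩
  obtain ⟨fm, f0, fi, f2, fP⟩ := pos hf hfi hf2
  obtain ⟨fm', f0', fi', f2', fP'⟩ := pos (f := fun a => -f a) hf.neg hfi.neg hf2.neg
  obtain ⟨gm, g0, gi, g2, gP⟩ := pos hg hgi hg2
  obtain ⟨gm', g0', gi', g2', gP'⟩ := pos (f := fun a => -g a) hg.neg hgi.neg hg2.neg
  -- Positive and negative parts reduce the formula, by bilinearity, to four nonnegative cases.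
  have e : ∀ᵐ ω ∂P, (∫ a, f a ∂M ω) * (∫ a, g a ∂M ω) =
      ((∫ a, max (f a) 0 ∂M ω) - ∫ a, max (-f a) 0 ∂M ω) *
        ((∫ a, max (g a) 0 ∂M ω) - ∫ a, max (-g a) 0 ∂M ω) := by
    filter_upwards [h.ae_integrable hf hfi, h.ae_integrable hg hgi] with ω h1 h2
    rw [integral_eq_pos_sub_neg h1, integral_eq_pos_sub_neg h2]
  have e3 : ∫ a, f a * g a ∂μ = ∫ a, (max (f a) 0 - max (-f a) 0) *
      (max (g a) 0 - max (-g a) 0) ∂μ := by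
    congr 1
    ext a
    rw [max_zero_sub_max_neg_zero_eq_self, max_zero_sub_max_neg_zero_eq_self]
  rw [integral_congr_ae e, e3, integral_sub_mul_sub fP fP' gP gP', integral_sub_mul_sub f2 f2' g2 g2',
    h.integral_integral_mul_integral_of_nonneg fm gm f0 g0 fi gi (f2.integrable_mul g2),
    h.integral_integral_mul_integral_of_nonneg fm gm' f0 g0' fi gi' (f2.integrable_mul g2'),
    h.integral_integral_mul_integral_of_nonneg fm' gm f0' g0 fi' gi (f2'.integrable_mul g2),
    h.integral_integral_mul_integral_of_nonneg fm' gm' f0' g0' fi' gi' (f2'.integrable_mul g2'),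
    integral_eq_pos_sub_neg hfi, integral_eq_pos_sub_neg hgi]
  ring

end IsPoissonRandomMeasure

end RealIntegrals

/-! ### Lebesgue measure on the half-line and a Gronwall inequality. -/

section Lebesgue

lemma lintegral_leb {f : ℝ≥0 → ℝ≥0∞} (hf : Measurable f) :
    ∫⁻ r, f r ∂leb = ∫⁻ x in Ici (0 : ℝ), f x.toNNReal :=
  lintegral_map hf measurable_real_toNNReal

lemma leb_Iic (t : ℝ≥0) : leb (Iic t) = t := by
  rw [leb, Measure.map_apply measurable_real_toNNReal measurableSet_Iic,
    Measure.restrict_apply (measurable_real_toNNReal measurableSet_Iic)]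
  have : Real.toNNReal ⁻¹' Iic t ∩ Ici 0 = Icc (0 : ℝ) t := by
    ext x
    simp only [mem_inter_iff, mem_preimage, mem_Iic, mem_Ici, mem_Icc, Real.toNNReal_le_iff_le_coe]
    tauto
  rw [this, Real.volume_Icc]
  simp

lemma leb_zero : leb {0} = 0 := by
  have := leb_Iic 0
  rwa [show Iic (0 : ℝ≥0) = {0} by ext; simp, ENNReal.coe_zero] at this

instance : SigmaFinite leb := by
  refine ⟨⟨⟨fun n => Iic (n : ℝ≥0), fun _ => trivial, fun n => ?_, ?_⟩⟩⟩
  · rw [leb_Iic]; exact ENNReal.coe_lt_top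
  · refine eq_univ_of_forall fun x => mem_iUnion.2 ?_
    exact exists_nat_ge x

instance (t : ℝ≥0) : IsFiniteMeasure (leb.restrict (Iic t)) :=
  ⟨by rw [Measure.restrict_apply_univ, leb_Iic]; exact ENNReal.coe_lt_top⟩

lemma ae_leb_ne_zero : ∀ᵐ r ∂leb, r ≠ 0 :=
  measure_eq_zero_iff_ae_notMem.1 leb_zero

lemma lintegral_exp_neg_leb {c : ℝ} (hc : 0 < c) :
    ∫⁻ r : ℝ≥0, ENNReal.ofReal (Real.exp (-c * r)) ∂leb = ENNReal.ofReal c⁻¹ := by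
  rw [lintegral_leb (by fun_prop), setLIntegral_congr Ioi_ae_eq_Ici.symm]
  have h1 : ∫⁻ x in Ioi (0 : ℝ), ENNReal.ofReal (Real.exp (-c * x.toNNReal)) =
      ∫⁻ x in Ioi (0 : ℝ), ENNReal.ofReal (Real.exp (-c * x)) :=
    setLIntegral_congr_fun measurableSet_Ioi fun x hx => by
      simp only [Real.coe_toNNReal x (le_of_lt hx)]
  rw [h1, ← ofReal_integral_eq_lintegral_ofReal (integrableOn_exp_mul_Ioi (by linarith) 0)
    (Eventually.of_forall fun x => (Real.exp_pos _).le), integral_exp_mul_Ioi (by linarith)]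
  congr 1
  simp

/-- A Gronwall inequality of convolution type. -/
lemma gronwall_convolution {g : ℝ≥0 → ℝ≥0∞} {T c C : ℝ≥0} {K : ℝ≥0∞} (hK : K ≠ ∞)
    (hgK : ∀ t, g t ≤ K) (hg : ∀ t ≤ T, g t ≤ c + C * ∫⁻ r in Iic t, g (t - r) ∂leb) (t : ℝ≥0)
    (ht : t ≤ T) : g t ≤ 2 * c * ENNReal.ofReal (Real.exp ((2 * C + 1) * t)) := by
  -- With the weight `e^{-l t}` the convolution term costs a factor `C / l ≤ 1/2` and can be
  -- absorbed.
  set l : ℝ := 2 * C + 1 with hl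
  have hl0 : 0 < l := by positivity
  let e : ℝ≥0 → ℝ≥0∞ := fun r => ENNReal.ofReal (Real.exp (-l * r))
  have he1 (r : ℝ≥0) : e r ≤ 1 := by
    simp only [e]
    rw [ENNReal.ofReal_le_one]
    exact Real.exp_le_one_iff.2 (by have := r.2; nlinarith)
  have hadd {r t : ℝ≥0} (h : r ≤ t) : e t = e r * e (t - r) := by
    simp only [e]
    rw [← ENNReal.ofReal_mul (Real.exp_pos _).le, ← Real.exp_add, NNReal.coe_sub h]
    congr 2
    ring
  let h : ℝ≥0∞ := ⨆ t ∈ Iic T, g t * e t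
  have hle {t : ℝ≥0} (ht : t ≤ T) : g t * e t ≤ h := le_iSup₂_of_le t ht le_rfl
  -- Only here is the a priori bound `K` needed: `h / 2` can be cancelled because it is finite.
  have hfin : h ≠ ∞ := by
    refine ne_top_of_le_ne_top hK (iSup₂_le fun t _ => ?_)
    exact (mul_le_of_le_one_right' (he1 t)).trans (hgK t)
  have hbound : h ≤ c + h / 2 := by
    refine iSup₂_le fun t ht => ?_
    calc g t * e t ≤ (c + C * ∫⁻ r in Iic t, g (t - r) ∂leb) * e t := by
          gcongr; exact hg t ht
      _ = c * e t + C * ∫⁻ r in Iic t, g (t - r) * e t ∂leb := by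
          rw [lintegral_mul_const' _ _ ENNReal.ofReal_ne_top]; ring
      _ ≤ c * 1 + C * ∫⁻ r in Iic t, h * e r ∂leb := by
          refine add_le_add (mul_le_mul_right (he1 t) _) (mul_le_mul_right
            (setLIntegral_mono' measurableSet_Iic fun r hr => ?_) _)
          rw [hadd (mem_Iic.1 hr), mul_comm (e r), ← mul_assoc]
          exact mul_le_mul_left (hle (tsub_le_self.trans ht)) (e r)
      _ ≤ c + C * (h * ENNReal.ofReal l⁻¹) := by
          have hh : h * ENNReal.ofReal l⁻¹ = ∫⁻ r, h * e r ∂leb := by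
            rw [lintegral_const_mul _ (by fun_prop), lintegral_exp_neg_leb hl0]
          rw [mul_one, hh]
          exact add_le_add_right (mul_le_mul_right (setLIntegral_le_lintegral _ _) _) _
      _ ≤ c + h / 2 := by
          have : (C : ℝ≥0∞) * ENNReal.ofReal l⁻¹ ≤ 2⁻¹ := by
            rw [← ENNReal.ofReal_coe_nnreal, ← ENNReal.ofReal_mul (NNReal.coe_nonneg C),
              show (2⁻¹ : ℝ≥0∞) = ENNReal.ofReal 2⁻¹ by
                rw [ENNReal.ofReal_inv_of_pos (by norm_num)]; simp]
            refine ENNReal.ofReal_le_ofReal ?_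
            rw [← div_eq_mul_inv, div_le_iff₀ hl0, hl]
            linarith
          rw [mul_left_comm, div_eq_mul_inv]
          gcongr
  have h2 : h ≤ 2 * c := by
    have h3 : h / 2 + h / 2 ≤ c + h / 2 := by rwa [ENNReal.add_halves]
    have h4 : h / 2 ≤ c :=
      (ENNReal.add_le_add_iff_right (ENNReal.div_ne_top hfin (by norm_num))).1 h3
    calc h = 2 * (h / 2) := (ENNReal.mul_div_cancel (by norm_num) (by norm_num)).symm
      _ ≤ 2 * c := by gcongr
  have h5 : e t * ENNReal.ofReal (Real.exp (l * t)) = 1 := by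
    simp only [e]
    rw [← ENNReal.ofReal_mul (Real.exp_pos _).le, ← Real.exp_add]
    simp
  calc g t = g t * e t * ENNReal.ofReal (Real.exp (l * t)) := by rw [mul_assoc, h5, mul_one]
    _ ≤ 2 * c * ENNReal.ofReal (Real.exp (l * t)) := by
      exact mul_le_mul_left ((hle ht).trans h2) _

lemma sq_lintegral_le {α : Type*} [MeasurableSpace α] (μ : Measure α) {f : α → ℝ≥0∞}
    (hf : AEMeasurable f μ) : (∫⁻ a, f a ∂μ) ^ 2 ≤ μ univ * ∫⁻ a, f a ^ 2 ∂μ := by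
  have h := ENNReal.lintegral_mul_le_Lp_mul_Lq μ Real.HolderConjugate.two_two hf
    (aemeasurable_const (b := (1 : ℝ≥0∞)))
  simp only [Pi.mul_apply, mul_one, one_pow, lintegral_const, one_mul, ENNReal.rpow_ofNat] at h
  calc (∫⁻ a, f a ∂μ) ^ 2
      ≤ ((∫⁻ a, f a ^ 2 ∂μ) ^ (1 / 2 : ℝ) * μ univ ^ (1 / 2 : ℝ)) ^ 2 := by gcongr
    _ = μ univ * ∫⁻ a, f a ^ 2 ∂μ := by
      rw [mul_pow, ← ENNReal.rpow_natCast, ← ENNReal.rpow_natCast, ← ENNReal.rpow_mul,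
        ← ENNReal.rpow_mul]
      norm_num
      rw [mul_comm]

end Lebesgue

/-! ### Joint measurability of evaluation on càdlàg paths. -/

section Paths

lemma measurable_eval_path (t : ℝ≥0) : Measurable fun z : Path => z.1 t :=
  (measurable_pi_apply t).comp measurable_subtype_coe

/-- Evaluation is jointly measurable, by right-continuity. -/
lemma measurable_eval : Measurable fun p : ℝ≥0 × Path => p.2.1 p.1 := by
  -- A point of the grid of mesh `1 / (n + 1)` just to the right of `t`: it has countably many
  -- values and tends to `t` from the right.
  let q (n : ℕ) (t : ℝ≥0) : ℝ≥0 := (⌊(n + 1 : ℝ≥0) * t⌋₊ + 1 : ℝ≥0) / (n + 1)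
  refine measurable_of_tendsto_metrizable (f := fun n (p : ℝ≥0 × Path) => p.2.1 (q n p.1))
    (fun n => ?_) (tendsto_pi_nhds.2 fun p => ?_)
  · have h1 : Measurable fun (p : Path × ℕ) => p.1.1 ((p.2 + 1 : ℝ≥0) / (n + 1)) :=
      measurable_from_prod_countable_left fun k =>
        measurable_eval_path ((k + 1 : ℝ≥0) / (n + 1))
    have h2 : Measurable fun (p : ℝ≥0 × Path) => (p.2, ⌊(n + 1 : ℝ≥0) * p.1⌋₊) :=
      measurable_snd.prodMk (Nat.measurable_floor.comp (measurable_fst.const_mul _))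
    exact h1.comp h2
  · have hq (n : ℕ) : p.1 ≤ q n p.1 ∧ q n p.1 ≤ p.1 + 1 / (n + 1) := by
      have hn : (0 : ℝ≥0) < n + 1 := by positivity
      constructor
      · rw [le_div_iff₀ hn, mul_comm]
        exact (Nat.lt_floor_add_one _).le
      · rw [div_le_iff₀ hn, add_mul p.1, one_div, inv_mul_cancel₀ hn.ne', mul_comm p.1]
        gcongr
        exact Nat.floor_le (by positivity)
    refine (p.2.2 p.1).1.tendsto.comp ?_
    refine tendsto_nhdsWithin_of_tendsto_nhds_of_eventually_within _ ?_
      (Eventually.of_forall fun n => (hq n).1)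
    refine tendsto_of_tendsto_of_tendsto_of_le_of_le tendsto_const_nhds ?_
      (fun n => (hq n).1) (fun n => (hq n).2)
    have : Tendsto (fun n : ℕ => p.1 + 1 / ((n : ℝ≥0) + 1)) atTop (𝓝 (p.1 + 0)) :=
      tendsto_const_nhds.add tendsto_one_div_add_atTop_nhds_zero_nat
    simpa using this

end Paths

/-! ### Marks: sums over twins. -/

section Marks

variable (lam : Measure ℕ) [IsProbabilityMeasure lam] (π : Measure Path) [IsProbabilityMeasure π]

instance : IsProbabilityMeasure (markLaw lam π) := by unfold markLaw; infer_instance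

instance : SigmaFinite (intensity lam π) := by unfold intensity; infer_instance

/-- A sum over the twins described by a mark is measurable. -/
lemma measurable_sum_twins {α β : Type*} [MeasurableSpace α] [MeasurableSpace β] [AddCommMonoid β]
    [MeasurableAdd₂ β] {φ : α → Path → β} (hφ : Measurable (Function.uncurry φ)) :
    Measurable fun p : α × Mark => ∑ i ∈ Finset.range p.2.1, φ p.1 (p.2.2 i) := by
  have h1 : Measurable fun p : (α × (ℕ → Path)) × ℕ =>
      ∑ i ∈ Finset.range p.2, φ p.1.1 (p.1.2 i) := by
    refine measurable_from_prod_countable_left fun n => ?_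
    change Measurable fun x : α × (ℕ → Path) => ∑ i ∈ Finset.range n, φ x.1 (x.2 i)
    refine Finset.measurable_fun_sum _ fun i _ => ?_
    exact hφ.comp (measurable_fst.prodMk ((measurable_pi_apply i).comp measurable_snd))
  have h2 : Measurable fun p : α × Mark => ((p.1, p.2.2), p.2.1) := by fun_prop
  exact h1.comp h2

lemma measurable_sum_twins' {β : Type*} [MeasurableSpace β] [AddCommMonoid β]
    [MeasurableAdd₂ β] {φ : Path → β} (hφ : Measurable φ) :
    Measurable fun m : Mark => ∑ i ∈ Finset.range m.1, φ (m.2 i) :=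
  (measurable_sum_twins (φ := fun (_ : Unit) z => φ z) (hφ.comp measurable_snd)).comp
    (measurable_const.prodMk measurable_id : Measurable fun m : Mark => ((), m))

lemma lintegral_eval_infinitePi {w : Path → ℝ≥0∞} (hw : Measurable w) (i : ℕ) :
    ∫⁻ z, w (z i) ∂Measure.infinitePi (fun _ : ℕ => π) = ∫⁻ z, w z ∂π := by
  have := measurePreserving_eval_infinitePi (fun _ : ℕ => π) i
  exact this.lintegral_comp hw

omit [IsProbabilityMeasure lam] in
-- Cauchy–Schwarz over the `l` twins gives one factor `l`, the `l` equal second moments give the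
-- other. Independence of the twins plays no role.
lemma lintegral_sum_twins_sq_le {w : Path → ℝ≥0∞} (hw : Measurable w) :
    ∫⁻ m, (∑ i ∈ Finset.range m.1, w (m.2 i)) ^ 2 ∂markLaw lam π ≤
      (∫⁻ l, (l : ℝ≥0∞) ^ 2 ∂lam) * ∫⁻ z, w z ^ 2 ∂π := by
  rw [markLaw, lintegral_prod _ ((measurable_sum_twins' hw).pow_const 2).aemeasurable,
    ← lintegral_mul_const _ (by fun_prop)]
  refine lintegral_mono fun l => ?_
  have h1 (z : ℕ → Path) : (∑ i ∈ Finset.range l, w (z i)) ^ 2 ≤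
      l * ∑ i ∈ Finset.range l, w (z i) ^ 2 := by
    have := ENNReal.inner_le_Lp_mul_Lq (Finset.range l) (fun i => w (z i)) (fun _ => 1)
      Real.HolderConjugate.two_two
    simp only [mul_one, one_pow, Finset.sum_const, Finset.card_range, nsmul_eq_mul,
      ENNReal.rpow_ofNat] at this
    calc (∑ i ∈ Finset.range l, w (z i)) ^ 2
        ≤ ((∑ i ∈ Finset.range l, w (z i) ^ 2) ^ (1 / 2 : ℝ) * (l : ℝ≥0∞) ^ (1 / 2 : ℝ)) ^ 2 := by
          gcongr
      _ = l * ∑ i ∈ Finset.range l, w (z i) ^ 2 := by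
        rw [mul_pow, ← ENNReal.rpow_natCast, ← ENNReal.rpow_natCast, ← ENNReal.rpow_mul,
          ← ENNReal.rpow_mul]
        norm_num
        rw [mul_comm]
  calc ∫⁻ z, (∑ i ∈ Finset.range l, w (z i)) ^ 2 ∂Measure.infinitePi (fun _ : ℕ => π)
      ≤ ∫⁻ z, l * ∑ i ∈ Finset.range l, w (z i) ^ 2 ∂Measure.infinitePi (fun _ : ℕ => π) :=
        lintegral_mono h1
    _ = l ^ 2 * ∫⁻ z, w z ^ 2 ∂π := by
        have hwi (i : ℕ) : Measurable fun z : ℕ → Path => w (z i) ^ 2 :=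
          (hw.pow_const 2).comp (measurable_pi_apply i)
        rw [lintegral_const_mul _ (Finset.measurable_fun_sum _ fun i _ => hwi i),
          lintegral_finsetSum _ fun i _ => hwi i]
        simp only [lintegral_eval_infinitePi π (hw.pow_const 2), Finset.sum_const,
          Finset.card_range, nsmul_eq_mul]
        ring

end Marks

/-! ### Integration over birth points. -/

section Points

variable (lam : Measure ℕ) [IsProbabilityMeasure lam] (π : Measure Path) [IsProbabilityMeasure π]

/-- The points which correspond to births before time `t`, for the birth rate `β`. -/
def birthSet (β : ℝ≥0 → ℝ≥0) (t : ℝ≥0) : Set Point := {a | a.1 ≤ t ∧ a.2.1 ≤ β a.1}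

lemma measurableSet_birthSet {β : ℝ≥0 → ℝ≥0} (hβ : Measurable β) (t : ℝ≥0) :
    MeasurableSet (birthSet β t) :=
  (measurableSet_le measurable_fst measurable_const).inter
    (measurableSet_le (α := ℝ≥0) (f := fun a : Point => a.2.1) (g := fun a => β a.1)
      measurable_snd.fst (hβ.comp measurable_fst))

/-- The integrand is free of the second coordinate `u`, so the constraint `u ≤ β r` integrates to
the factor `β r`. -/
lemma lintegral_birthSet {β : ℝ≥0 → ℝ≥0} (hβ : Measurable β) (t : ℝ≥0)
    {H : ℝ≥0 × Mark → ℝ≥0∞} (hH : Measurable H) :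
    ∫⁻ a in birthSet β t, H (a.1, a.2.2) ∂intensity lam π =
      ∫⁻ r in Iic t, β r * ∫⁻ m, H (r, m) ∂markLaw lam π ∂leb := by
  have hH' : Measurable fun a : Point => H (a.1, a.2.2) := by fun_prop
  rw [← lintegral_indicator (measurableSet_birthSet hβ t), intensity,
    lintegral_prod _ (hH'.indicator (measurableSet_birthSet hβ t)).aemeasurable,
    ← lintegral_indicator measurableSet_Iic]
  refine lintegral_congr fun r => ?_
  by_cases hr : r ≤ t
  · rw [indicator_of_mem (mem_Iic.2 hr)]
    have e : ∀ p : ℝ≥0 × Mark, (birthSet β t).indicator (fun a => H (a.1, a.2.2)) (r, p) =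
        (Iic (β r)).indicator (fun _ => (1 : ℝ≥0∞)) p.1 * H (r, p.2) := fun p => by
      by_cases hp : p.1 ≤ β r
      · rw [indicator_of_mem (show (r, p) ∈ birthSet β t from ⟨hr, hp⟩), indicator_of_mem (mem_Iic.2 hp), one_mul]
      · rw [indicator_of_notMem (show (r, p) ∉ birthSet β t from fun h => hp h.2),
          indicator_of_notMem (by simpa using hp), zero_mul]
    simp_rw [e]
    rw [lintegral_prod_mul (f := (Iic (β r)).indicator fun _ => (1 : ℝ≥0∞))
      (g := fun m => H (r, m)) (measurable_const.indicator measurableSet_Iic).aemeasurable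
      (hH.comp measurable_prodMk_left).aemeasurable, lintegral_indicator measurableSet_Iic]
    simp [leb_Iic]
  · rw [indicator_of_notMem (by simpa using hr)]
    have e : ∀ p : ℝ≥0 × Mark, (birthSet β t).indicator (fun a => H (a.1, a.2.2)) (r, p) = 0 :=
      fun p => indicator_of_notMem (fun h => hr h.1) _
    simp [e]

end Points

/-- Passage to the canonical space of measures, so that type and random measure can be studied under
a product law `ν ⊗ Q`. -/
lemma IsPoissonRandomMeasure.id_map {Ω E : Type*} [MeasurableSpace Ω] [MeasurableSpace E]
    {M : Ω → Measure E} {μ : Measure E} {P : Measure Ω} [IsProbabilityMeasure P]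
    (h : IsPoissonRandomMeasure M μ P) : IsPoissonRandomMeasure id μ (P.map M) := by
  have hc {A : Set E} (hA : MeasurableSet A) : Measurable fun m : Measure E => m A :=
    Measure.measurable_coe hA
  have := Measure.isProbabilityMeasure_map (μ := P) h.measurable.aemeasurable
  refine ⟨measurable_id, fun A hA hf => ?_, fun A hA hf => ?_, fun n A hA hd => ?_⟩
  · rw [← h.poisson A hA hf]
    exact Measure.map_map (hc hA) h.measurable
  · exact (ae_map_iff h.measurable.aemeasurable (hc hA (measurableSet_singleton _))).2
      (h.infinite A hA hf)
  · have h1 := (iIndepFun_iff_map_fun_eq_pi_map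
      fun i => (h.measurable_apply (hA i)).aemeasurable).1 (h.indep n A hA hd)
    refine (iIndepFun_iff_map_fun_eq_pi_map fun i => (hc (hA i)).aemeasurable).2 ?_
    have h2 : Measurable fun (m : Measure E) i => m (A i) := measurable_pi_lambda _ fun i => hc (hA i)
    have h3 (i : Fin n) : (P.map M).map (fun m : Measure E => (id m : Measure E) (A i)) = P.map fun ω => M ω (A i) :=
      Measure.map_map (hc (hA i)) h.measurable
    refine Eq.trans ?_ (congrArg Measure.pi (funext h3)).symm
    rw [← h1]
    exact Measure.map_map h2 h.measurable

/-! ### Poisson integrals of integrands depending on an independent type. -/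

section Mixed

variable {S E : Type*} [MeasurableSpace S] [MeasurableSpace E] {ν : Measure S}
  {μ : Measure E} [SigmaFinite μ] {Q : Measure (Measure E)} [IsProbabilityMeasure Q]

lemma measurable_lintegral_idKernel (μ : Measure E) [SigmaFinite μ] {F : S → E → ℝ≥0∞}
    (hF : Measurable (Function.uncurry F)) :
    Measurable fun p : S × Measure E => ∫⁻ a, F p.1 a ∂idKernel μ p.2 :=
  Measurable.lintegral_kernel_prod_right (κ := Kernel.prodMkLeft S (idKernel μ))
    (f := fun (p : S × Measure E) a => F p.1 a)
    (hF.comp (measurable_fst.fst.prodMk measurable_snd))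

lemma stronglyMeasurable_integral_idKernel (μ : Measure E) [SigmaFinite μ] {F : S → E → ℝ}
    (hF : Measurable (Function.uncurry F)) :
    StronglyMeasurable fun p : S × Measure E => ∫ a, F p.1 a ∂idKernel μ p.2 :=
  StronglyMeasurable.integral_kernel_prod_right (κ := Kernel.prodMkLeft S (idKernel μ))
    (f := fun (p : S × Measure E) a => F p.1 a)
    (hF.comp (measurable_fst.fst.prodMk measurable_snd)).stronglyMeasurable

namespace IsPoissonRandomMeasure

lemma ae_prod_idKernel_eq [SFinite ν] (hQ : IsPoissonRandomMeasure id μ Q) :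
    ∀ᵐ p ∂ν.prod Q, idKernel μ p.2 = p.2 :=
  Measure.quasiMeasurePreserving_snd.ae hQ.ae_idKernel_eq

/-- The truncation bound holds for each fixed type and almost every `m`. Written with `idKernel`,
both sides are jointly measurable, so Fubini makes it hold almost everywhere on the product. -/
lemma ae_prod_min_le [SFinite ν] (hQ : IsPoissonRandomMeasure id μ Q) {F : S → E → ℝ≥0∞}
    (hF : Measurable (Function.uncurry F)) (K : ℝ≥0∞) :
    ∀ᵐ p ∂ν.prod Q, min (∫⁻ a, F p.1 a ∂p.2) K ≤ ∫⁻ a, min (F p.1 a) K ∂idKernel μ p.2 := by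
  have h1 : ∀ᵐ p ∂ν.prod Q, min (∫⁻ a, F p.1 a ∂idKernel μ p.2) K ≤
      ∫⁻ a, min (F p.1 a) K ∂idKernel μ p.2 := by
    refine (Measure.ae_prod_iff_ae_ae (measurableSet_le
      ((measurable_lintegral_idKernel μ hF).min measurable_const)
      (measurable_lintegral_idKernel μ (F := fun x a => min (F x a) K)
        (hF.min measurable_const)))).2 (Eventually.of_forall fun x => ?_)
    have hFx : Measurable (F x) := hF.of_uncurry_left
    filter_upwards [hQ.ae_idKernel_eq, hQ.ae_min_lintegral_le hFx K] with m hm h2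
    simp only [id] at hm h2
    simpa only [hm] using h2
  filter_upwards [h1, hQ.ae_prod_idKernel_eq] with p hp hp'
  simpa only [hp'] using hp

lemma lintegral_prod_sq [SFinite ν] (hQ : IsPoissonRandomMeasure id μ Q) {F : S → E → ℝ≥0∞}
    (hF : Measurable (Function.uncurry F)) :
    ∫⁻ p, (∫⁻ a, F p.1 a ∂idKernel μ p.2) ^ 2 ∂ν.prod Q =
      ∫⁻ x, ∫⁻ a, F x a ^ 2 ∂μ + (∫⁻ a, F x a ∂μ) ^ 2 ∂ν := by
  rw [lintegral_prod _ ((measurable_lintegral_idKernel μ hF).pow_const 2).aemeasurable]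
  refine lintegral_congr fun x => ?_
  have hFx : Measurable (F x) := hF.of_uncurry_left
  have h1 := hQ.lintegral_lintegral_mul_lintegral hFx hFx
  simp only [id, ← sq] at h1
  rw [← h1]
  refine lintegral_congr_ae ?_
  filter_upwards [hQ.ae_idKernel_eq] with m hm
  simp only [id] at hm
  simp only [hm]

end IsPoissonRandomMeasure

end Mixed

/-! ### The integrand of the branching equation. -/

section Points

/-- The integrand of `pointIntegral`. -/
def pointFun (β : ℝ≥0 → ℝ≥0) (t : ℝ≥0) : Point → ℝ :=
  (birthSet β t).indicator fun a => ∑ i ∈ Finset.range a.2.2.1, (a.2.2.2 i).1 (t - a.1)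

lemma pointIntegral_eq {β : ℝ≥0 → ℝ≥0} (hβ : Measurable β) (t : ℝ≥0) (m : Measure Point) :
    pointIntegral β t m = ∫ a, pointFun β t a ∂m :=
  (integral_indicator (measurableSet_birthSet hβ t)).symm

lemma measurable_eval_sub (t : ℝ≥0) :
    Measurable (Function.uncurry fun (r : ℝ≥0) (z : Path) => z.1 (t - r)) :=
  measurable_eval.comp ((measurable_const.sub measurable_fst).prodMk measurable_snd)

lemma measurable_pointFun {S : Type*} [MeasurableSpace S] {b : ℝ≥0 → S → ℝ≥0}
    (hb : Measurable (Function.uncurry b)) (t : ℝ≥0) :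
    Measurable fun p : S × Point => pointFun (fun s => b s p.1) t p.2 := by
  have h1 : Measurable fun p : S × Point =>
      ∑ i ∈ Finset.range p.2.2.2.1, (p.2.2.2.2 i).1 (t - p.2.1) :=
    (measurable_sum_twins (measurable_eval_sub t)).comp
      (measurable_snd.fst.prodMk measurable_snd.snd.snd)
  have h2 : MeasurableSet {p : S × Point | p.2.1 ≤ t ∧ p.2.2.1 ≤ b p.2.1 p.1} :=
    (measurableSet_le measurable_snd.fst measurable_const).inter
      (measurableSet_le (f := fun p : S × Point => p.2.2.1) (g := fun p => b p.2.1 p.1)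
        measurable_snd.snd.fst (hb.comp (measurable_snd.fst.prodMk measurable_fst)))
  exact h1.indicator h2

variable (lam : Measure ℕ) [IsProbabilityMeasure lam] (π : Measure Path) [IsProbabilityMeasure π]

lemma measurable_section {w : ℝ≥0 × Path → ℝ≥0∞} (hw : Measurable w) (r : ℝ≥0) :
    Measurable fun z => w (r, z) := hw.comp measurable_prodMk_left

lemma lintegral_birthSet_sq_le {β : ℝ≥0 → ℝ≥0} (hβ : Measurable β) (t : ℝ≥0)
    {w : ℝ≥0 × Path → ℝ≥0∞} (hw : Measurable w) :
    ∫⁻ a in birthSet β t, (∑ i ∈ Finset.range a.2.2.1, w (a.1, a.2.2.2 i)) ^ 2 ∂intensity lam π ≤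
      (∫⁻ l, (l : ℝ≥0∞) ^ 2 ∂lam) * ∫⁻ r in Iic t, β r * ∫⁻ z, w (r, z) ^ 2 ∂π ∂leb := by
  have hH : Measurable fun p : ℝ≥0 × Mark => (∑ i ∈ Finset.range p.2.1, w (p.1, p.2.2 i)) ^ 2 :=
    (measurable_sum_twins (φ := fun r z => w (r, z)) hw).pow_const 2
  have hm : Measurable fun r : ℝ≥0 => β r * ∫⁻ z, w (r, z) ^ 2 ∂π :=
    hβ.coe_nnreal_ennreal.mul (hw.pow_const 2).lintegral_prod_right'
  rw [lintegral_birthSet lam π hβ t hH, ← lintegral_const_mul _ hm]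
  refine lintegral_mono fun r => ?_
  calc (β r : ℝ≥0∞) * ∫⁻ m, (∑ i ∈ Finset.range m.1, w (r, m.2 i)) ^ 2 ∂markLaw lam π
      ≤ β r * ((∫⁻ l, (l : ℝ≥0∞) ^ 2 ∂lam) * ∫⁻ z, w (r, z) ^ 2 ∂π) := by
        gcongr; exact lintegral_sum_twins_sq_le lam π (measurable_section hw r)
    _ = _ := by ring

/-- Cauchy–Schwarz twice: in time on `[0, t]`, which costs the factor `t`, and over the marks, which
form a probability space. -/
lemma sq_lintegral_birthSet_le {β : ℝ≥0 → ℝ≥0} (hβ : Measurable β) (t : ℝ≥0)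
    {w : ℝ≥0 × Path → ℝ≥0∞} (hw : Measurable w) :
    (∫⁻ a in birthSet β t, ∑ i ∈ Finset.range a.2.2.1, w (a.1, a.2.2.2 i) ∂intensity lam π) ^ 2 ≤
      (∫⁻ l, (l : ℝ≥0∞) ^ 2 ∂lam) *
        ∫⁻ r in Iic t, (t * (β r : ℝ≥0∞) ^ 2) * ∫⁻ z, w (r, z) ^ 2 ∂π ∂leb := by
  have hH : Measurable fun p : ℝ≥0 × Mark => ∑ i ∈ Finset.range p.2.1, w (p.1, p.2.2 i) :=
    measurable_sum_twins (φ := fun r z => w (r, z)) hw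
  have hm : Measurable fun r : ℝ≥0 => (t * (β r : ℝ≥0∞) ^ 2) * ∫⁻ z, w (r, z) ^ 2 ∂π :=
    ((hβ.coe_nnreal_ennreal.pow_const 2).const_mul _).mul (hw.pow_const 2).lintegral_prod_right'
  have hm' : Measurable fun r : ℝ≥0 =>
      (β r : ℝ≥0∞) * ∫⁻ m, (∑ i ∈ Finset.range m.1, w (r, m.2 i)) ∂markLaw lam π :=
    hβ.coe_nnreal_ennreal.mul hH.lintegral_prod_right'
  rw [lintegral_birthSet lam π hβ t hH, ← lintegral_const_mul _ hm]
  refine (sq_lintegral_le _ hm'.aemeasurable).trans ?_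
  rw [Measure.restrict_apply_univ, leb_Iic, ← lintegral_const_mul _ (hm'.pow_const 2)]
  refine lintegral_mono fun r => ?_
  have h1 : (∫⁻ m, (∑ i ∈ Finset.range m.1, w (r, m.2 i)) ∂markLaw lam π) ^ 2 ≤
      (∫⁻ l, (l : ℝ≥0∞) ^ 2 ∂lam) * ∫⁻ z, w (r, z) ^ 2 ∂π := by
    refine (sq_lintegral_le _
      (measurable_sum_twins' (measurable_section hw r)).aemeasurable).trans ?_
    rw [measure_univ, one_mul]
    exact lintegral_sum_twins_sq_le lam π (measurable_section hw r)
  rw [mul_pow]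
  calc (t : ℝ≥0∞) * ((β r : ℝ≥0∞) ^ 2 *
        (∫⁻ m, (∑ i ∈ Finset.range m.1, w (r, m.2 i)) ∂markLaw lam π) ^ 2)
      ≤ t * ((β r : ℝ≥0∞) ^ 2 * ((∫⁻ l, (l : ℝ≥0∞) ^ 2 ∂lam) * ∫⁻ z, w (r, z) ^ 2 ∂π)) := by
        gcongr
    _ = _ := by ring

/-- A bound for the sum of the first term and of the second term in the formula for the second
moment of a Poisson integral. -/
lemma lintegral_sq_add_sq_lintegral_le {β : ℝ≥0 → ℝ≥0} (hβ : Measurable β) (t : ℝ≥0)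
    {w : ℝ≥0 × Path → ℝ≥0∞} (hw : Measurable w) {f : Point → ℝ≥0∞}
    (hf : ∀ a, f a ≤ (birthSet β t).indicator
      (fun a => ∑ i ∈ Finset.range a.2.2.1, w (a.1, a.2.2.2 i)) a) :
    ∫⁻ a, f a ^ 2 ∂intensity lam π + (∫⁻ a, f a ∂intensity lam π) ^ 2 ≤
      (∫⁻ l, (l : ℝ≥0∞) ^ 2 ∂lam) *
        ∫⁻ r in Iic t, (β r + t * (β r : ℝ≥0∞) ^ 2) * ∫⁻ z, w (r, z) ^ 2 ∂π ∂leb := by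
  have hB := measurableSet_birthSet hβ t
  have hm1 : Measurable fun r : ℝ≥0 => β r * ∫⁻ z, w (r, z) ^ 2 ∂π :=
    hβ.coe_nnreal_ennreal.mul (hw.pow_const 2).lintegral_prod_right'
  simp_rw [add_mul]
  rw [lintegral_add_left hm1, mul_add]
  refine add_le_add ?_ ?_
  · refine le_trans ?_ (lintegral_birthSet_sq_le lam π hβ t hw)
    rw [← lintegral_indicator hB]
    refine lintegral_mono fun a => ?_
    by_cases ha : a ∈ birthSet β t
    · have := hf a
      rw [indicator_of_mem ha] at this
      rw [indicator_of_mem ha]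
      gcongr
    · have := hf a
      rw [indicator_of_notMem ha, nonpos_iff_eq_zero] at this
      simp [this]
  · refine le_trans ?_ (sq_lintegral_birthSet_le lam π hβ t hw)
    rw [← lintegral_indicator hB]
    gcongr with a
    exact hf a

end Points

/-! ### Local boundedness of the second moment of the population. -/

section SecondMoment

variable {S Ω : Type*} [MeasurableSpace S] [MeasurableSpace Ω]
  {ν : Measure S} [IsProbabilityMeasure ν] {b : ℝ≥0 → S → ℝ≥0} {η : S → ℝ≥0}
  {lam : Measure ℕ} [IsProbabilityMeasure lam] {π : Measure Path} [IsProbabilityMeasure π]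
  {P : Measure Ω} [IsProbabilityMeasure P] {X : ℕ → Ω → S} {M : ℕ → Ω → Measure Point}
  {Z : ℕ → Ω → Path}

omit [IsProbabilityMeasure ν] [IsProbabilityMeasure lam] in
-- The supremum runs over an open interval: enlarging it to `T + 1` includes `T`, while time `0`
-- stays excluded and is Lebesgue-null.
lemma SecondMoments.exists_bound (h : SecondMoments ν b lam) (T : ℝ≥0) :
    ∃ B : ℝ≥0, ∀ t, t ≠ 0 → t ≤ T → ∫⁻ y, (b t y : ℝ≥0∞) ^ 2 ∂ν ≤ B := by
  have h1 := h.2 (T + 1) (by positivity)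
  refine ⟨(⨆ t ∈ Ioo 0 (T + 1), ∫⁻ y, (b t y : ℝ≥0∞) ^ 2 ∂ν).toNNReal, fun t ht hT => ?_⟩
  rw [ENNReal.coe_toNNReal h1.ne]
  exact le_iSup₂_of_le t ⟨pos_iff_ne_zero.2 ht, hT.trans_lt (by simp)⟩ le_rfl

lemma measurable_rate_left (hb : Measurable (Function.uncurry b)) (x : S) :
    Measurable fun s => b s x := hb.comp measurable_prodMk_right

lemma measurable_rate_right (hb : Measurable (Function.uncurry b)) (s : ℝ≥0) :
    Measurable (b s) := hb.comp measurable_prodMk_left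

/-- Moments of birth rates, integrated against a function of time. -/
lemma lintegral_rate_mul_le (hb : Measurable (Function.uncurry b)) {T B : ℝ≥0}
    (hB : ∀ t, t ≠ 0 → t ≤ T → ∫⁻ y, (b t y : ℝ≥0∞) ^ 2 ∂ν ≤ B) {t : ℝ≥0} (ht : t ≤ T)
    {g : ℝ≥0 → ℝ≥0∞} (hg : Measurable g) :
    ∫⁻ x, ∫⁻ r in Iic t, (b r x + t * (b r x : ℝ≥0∞) ^ 2) * g r ∂leb ∂ν ≤
      (1 + B + T * B) * ∫⁻ r in Iic t, g r ∂leb := by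
  have hm : Measurable (Function.uncurry fun (x : S) (r : ℝ≥0) =>
      (b r x + t * (b r x : ℝ≥0∞) ^ 2) * g r) := by
    have h1 : Measurable fun p : S × ℝ≥0 => b p.2 p.1 := hb.comp measurable_swap
    exact ((h1.coe_nnreal_ennreal.add ((h1.coe_nnreal_ennreal.pow_const 2).const_mul _))).mul
      (hg.comp measurable_snd)
  rw [lintegral_lintegral_swap hm.aemeasurable, ← lintegral_const_mul _ hg]
  refine lintegral_mono_ae ?_
  filter_upwards [ae_restrict_of_ae ae_leb_ne_zero, ae_restrict_mem measurableSet_Iic] with r h0 hr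
  have hbr := (measurable_rate_right hb r).coe_nnreal_ennreal
  have h2 := hB r h0 ((mem_Iic.1 hr).trans ht)
  rw [lintegral_mul_const _ (by fun_prop), lintegral_add_left hbr,
    lintegral_const_mul _ (hbr.pow_const 2)]
  gcongr
  calc ∫⁻ x, (b r x : ℝ≥0∞) ∂ν ≤ ∫⁻ x, 1 + (b r x : ℝ≥0∞) ^ 2 ∂ν := by
        refine lintegral_mono fun x => ?_
        have : b r x ≤ 1 + b r x ^ 2 := by
          rw [← NNReal.coe_le_coe]
          push_cast
          nlinarith [sq_nonneg ((b r x : ℝ) - 1)]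
        rw [← ENNReal.coe_pow, ← ENNReal.coe_one, ← ENNReal.coe_add]
        exact ENNReal.coe_le_coe.2 this
    _ = 1 + ∫⁻ x, (b r x : ℝ≥0∞) ^ 2 ∂ν := by rw [lintegral_add_left measurable_const]; simp
    _ ≤ 1 + B := by gcongr

lemma min_enorm_add_le (x y : ℝ) (K : ℝ≥0∞) : min ‖x + y‖ₑ K ≤ min ‖x‖ₑ K + min ‖y‖ₑ K := by
  refine (min_le_min_right K (enorm_add_le x y)).trans ?_
  rcases le_total ‖x‖ₑ K with h1 | h1
  · rcases le_total ‖y‖ₑ K with h2 | h2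
    · rw [min_eq_left h1, min_eq_left h2]; exact min_le_left _ _
    · rw [min_eq_right h2]; exact (min_le_right _ _).trans le_add_self
  · rw [min_eq_right h1]; exact (min_le_right _ _).trans le_self_add

lemma min_enorm_sum_le {ι : Type*} (s : Finset ι) (f : ι → ℝ) (K : ℝ≥0∞) :
    min ‖∑ i ∈ s, f i‖ₑ K ≤ ∑ i ∈ s, min ‖f i‖ₑ K :=
  Finset.le_sum_of_subadditive (fun x : ℝ => min ‖x‖ₑ K) (by simp)
    (fun x y => min_enorm_add_le x y K) s f

lemma one_add_sq_le (A : ℝ≥0∞) : (1 + A) ^ 2 ≤ 2 + 2 * A ^ 2 := by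
  induction A with
  | top => simp
  | coe A =>
    have : (1 + A) ^ 2 ≤ 2 + 2 * A ^ 2 := by
      rw [← NNReal.coe_le_coe]
      push_cast
      nlinarith [sq_nonneg ((A : ℝ) - 1)]
    exact_mod_cast this

namespace IsCMJ

omit [IsProbabilityMeasure ν] [IsProbabilityMeasure lam] [IsProbabilityMeasure π] in
lemma map_prod (hZ : IsCMJ ν b η lam π P X M Z) (k : ℕ) :
    P.map (fun ω => (X k ω, M k ω)) = ν.prod (P.map (M k)) := by
  rw [(indepFun_iff_map_prod_eq_prod_map_map (hZ.measurable_type k).aemeasurable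
    (hZ.poisson k).measurable.aemeasurable).1 (hZ.indep_type k), hZ.law_type k]

/-- The truncated second moment satisfies a renewal inequality. -/
lemma lintegral_min_sq_le (hZ : IsCMJ ν b η lam π P X M Z) (hb : Measurable (Function.uncurry b))
    (hl : ∫⁻ l, (l : ℝ≥0∞) ^ 2 ∂lam ≠ ∞)
    {T B : ℝ≥0} (hB : ∀ t, t ≠ 0 → t ≤ T → ∫⁻ y, (b t y : ℝ≥0∞) ^ 2 ∂ν ≤ B) {t : ℝ≥0} (ht : t ≤ T)
    (K : ℝ≥0∞) :
    ∫⁻ z, (min ‖z.1 t‖ₑ K) ^ 2 ∂π ≤ 2 + 2 * ((∫⁻ l, (l : ℝ≥0∞) ^ 2 ∂lam) *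
      ((1 + B + T * B) * ∫⁻ r in Iic t, ∫⁻ z, (min ‖z.1 (t - r)‖ₑ K) ^ 2 ∂π ∂leb)) := by
  set μ := intensity lam π
  set Q := P.map (M 0)
  have : IsProbabilityMeasure Q :=
    Measure.isProbabilityMeasure_map (hZ.poisson 0).measurable.aemeasurable
  have hQ : IsPoissonRandomMeasure id μ Q := (hZ.poisson 0).id_map
  let W (x : S) (a : Point) : ℝ≥0∞ := min ‖pointFun (fun s => b s x) t a‖ₑ K
  have hF : Measurable (Function.uncurry fun x a => ‖pointFun (fun s => b s x) t a‖ₑ) :=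
    (measurable_pointFun hb t).enorm
  have hW : Measurable (Function.uncurry W) := hF.min measurable_const
  have hmin : ∀ᵐ p ∂ν.prod Q, min (∫⁻ a, ‖pointFun (fun s => b s p.1) t a‖ₑ ∂p.2) K ≤
      ∫⁻ a, W p.1 a ∂idKernel μ p.2 := hQ.ae_prod_min_le hF K
  have hmin' : ∀ᵐ ω ∂P, min ‖pointIntegral (fun s => b s (X 0 ω)) t (M 0 ω)‖ₑ K ≤
      ∫⁻ a, W (X 0 ω) a ∂idKernel μ (M 0 ω) := by
    have hXM : AEMeasurable (fun ω => (X 0 ω, M 0 ω)) P :=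
      ((hZ.measurable_type 0).prodMk (hZ.poisson 0).measurable).aemeasurable
    rw [← hZ.map_prod 0] at hmin
    filter_upwards [ae_of_ae_map hXM hmin] with ω hω
    refine le_trans (min_le_min_right K ?_) hω
    rw [pointIntegral_eq (measurable_rate_left hb _)]
    exact enorm_integral_le_lintegral_enorm _
  have hsq : Measurable fun z : Path => (min ‖z.1 t‖ₑ K) ^ 2 :=
    ((measurable_eval_path t).enorm.min measurable_const).pow_const 2
  have hw : Measurable fun p : ℝ≥0 × Path => min ‖p.2.1 (t - p.1)‖ₑ K :=
    (measurable_eval_sub t).enorm.min measurable_const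
  calc ∫⁻ z, (min ‖z.1 t‖ₑ K) ^ 2 ∂π
      = ∫⁻ ω, (min ‖(Z 0 ω).1 t‖ₑ K) ^ 2 ∂P := by
        rw [← hZ.law_path 0, lintegral_map hsq (hZ.measurable_path 0)]
    _ ≤ ∫⁻ ω, 2 + 2 * (∫⁻ a, W (X 0 ω) a ∂idKernel μ (M 0 ω)) ^ 2 ∂P := by
        refine lintegral_mono_ae ?_
        filter_upwards [hZ.branching 0, hmin'] with ω h1 h2
        -- The ancestor contributes at most one, and `(1 + A)² ≤ 2 + 2 A²` separates it from its
        -- descendants.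
        have h4 : min ‖(if t < η (X 0 ω) then (1 : ℝ) else 0)‖ₑ K ≤ 1 := by
          refine (min_le_left _ _).trans ?_
          split_ifs <;> simp
        rw [h1 t]
        exact (pow_le_pow_left' ((min_enorm_add_le _ _ K).trans (add_le_add h4 h2)) 2).trans
          (one_add_sq_le _)
    _ = ∫⁻ p, 2 + 2 * (∫⁻ a, W p.1 a ∂idKernel μ p.2) ^ 2 ∂ν.prod Q := by
        rw [← hZ.map_prod 0, lintegral_map ((((measurable_lintegral_idKernel μ hW).pow_const
          2).const_mul 2).const_add 2) ((hZ.measurable_type 0).prodMk (hZ.poisson 0).measurable)]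
    _ = 2 + 2 * ∫⁻ x, ∫⁻ a, W x a ^ 2 ∂μ + (∫⁻ a, W x a ∂μ) ^ 2 ∂ν := by
        rw [lintegral_add_left measurable_const,
          lintegral_const_mul _ ((measurable_lintegral_idKernel μ hW).pow_const 2),
          hQ.lintegral_prod_sq hW]
        simp only [lintegral_const, measure_univ, mul_one]
    _ ≤ 2 + 2 * ∫⁻ x, (∫⁻ l, (l : ℝ≥0∞) ^ 2 ∂lam) * ∫⁻ r in Iic t,
          (b r x + t * (b r x : ℝ≥0∞) ^ 2) * ∫⁻ z, (min ‖z.1 (t - r)‖ₑ K) ^ 2 ∂π ∂leb ∂ν := by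
        gcongr with x
        refine lintegral_sq_add_sq_lintegral_le lam π (measurable_rate_left hb x) t hw fun a => ?_
        simp only [W, pointFun]
        by_cases ha : a ∈ birthSet (fun s => b s x) t
        · rw [indicator_of_mem ha, indicator_of_mem ha]
          -- Truncation is subadditive over twins. Each child has law `π`, so the truncated moment
          -- reappears on the right.
          exact min_enorm_sum_le _ _ _
        · rw [indicator_of_notMem ha]; simp
    _ ≤ _ := by
        have hm : Measurable fun r : ℝ≥0 => ∫⁻ z, (min ‖z.1 (t - r)‖ₑ K) ^ 2 ∂π :=
          (hw.pow_const 2).lintegral_prod_right'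
        gcongr
        refine le_trans ?_ (mul_le_mul_right (lintegral_rate_mul_le hb hB ht hm) _)
        rw [lintegral_const_mul' _ _ hl]

/-- Second moments of the number of living descendants are bounded on bounded time intervals. -/
lemma exists_lintegral_sq_le (hZ : IsCMJ ν b η lam π P X M Z)
    (hb : Measurable (Function.uncurry b)) (hmom : SecondMoments ν b lam) (T : ℝ≥0) :
    ∃ C : ℝ≥0, ∀ t ≤ T, ∫⁻ z, ‖z.1 t‖ₑ ^ 2 ∂π ≤ C := by
  obtain ⟨B, hB⟩ := hmom.exists_bound T
  have hl : ∫⁻ l, (l : ℝ≥0∞) ^ 2 ∂lam ≠ ∞ := hmom.1.ne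
  set ℓ : ℝ≥0 := (∫⁻ l, (l : ℝ≥0∞) ^ 2 ∂lam).toNNReal with hℓ
  have hℓ' : ∫⁻ l, (l : ℝ≥0∞) ^ 2 ∂lam = ℓ := (ENNReal.coe_toNNReal hl).symm
  -- `C` is the coefficient of the renewal inequality and `D` the resulting Gronwall bound at time
  -- `T`; neither depends on the truncation level.
  let C : ℝ≥0 := 2 * (ℓ * (1 + B + T * B))
  let D : ℝ≥0 := 2 * 2 * (Real.exp ((2 * C + 1) * T)).toNNReal
  have hK (K : ℕ) {t : ℝ≥0} (ht : t ≤ T) : ∫⁻ z, (min ‖z.1 t‖ₑ K) ^ 2 ∂π ≤ D := by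
    refine (gronwall_convolution (g := fun t => ∫⁻ z, (min ‖z.1 t‖ₑ K) ^ 2 ∂π) (c := 2) (C := C)
      (K := (K : ℝ≥0∞) ^ 2) (T := T) (by simp) (fun t => ?_) (fun t ht => ?_) t ht).trans ?_
    · calc ∫⁻ z, (min ‖z.1 t‖ₑ K) ^ 2 ∂π ≤ ∫⁻ _, (K : ℝ≥0∞) ^ 2 ∂π := by
            refine lintegral_mono fun z => ?_
            gcongr
            exact min_le_right _ _
        _ = (K : ℝ≥0∞) ^ 2 := by simp
    · refine (hZ.lintegral_min_sq_le hb hl hB ht K).trans (le_of_eq ?_)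
      rw [hℓ']
      simp only [C]
      push_cast
      ring
    · simp only [D, ENNReal.coe_mul, ENNReal.coe_ofNat]
      gcongr
      change _ ≤ ENNReal.ofReal _
      gcongr
  refine ⟨D, fun t ht => ?_⟩
  -- Monotone convergence removes the truncation.
  have hlim : ∫⁻ z, ‖z.1 t‖ₑ ^ 2 ∂π = ⨆ K : ℕ, ∫⁻ z, (min ‖z.1 t‖ₑ K) ^ 2 ∂π := by
    rw [← lintegral_iSup]
    · refine lintegral_congr fun z => le_antisymm ?_ (iSup_le fun K => ?_)
      · obtain ⟨K, hK⟩ := ENNReal.exists_nat_gt (enorm_ne_top (x := z.1 t))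
        exact le_iSup_of_le K (by rw [min_eq_left hK.le])
      · gcongr
        exact min_le_left _ _
    · exact fun K => ((measurable_eval_path t).enorm.min measurable_const).pow_const 2
    · intro K K' h z
      dsimp only
      gcongr
  rw [hlim]
  exact iSup_le fun K => hK K ht

end IsCMJ

end SecondMoment

lemma memLp_two_iff_lintegral {α : Type*} [MeasurableSpace α] {μ : Measure α} {f : α → ℝ}
    (hf : AEStronglyMeasurable f μ) : MemLp f 2 μ ↔ ∫⁻ a, ‖f a‖ₑ ^ 2 ∂μ < ∞ := by
  have h := eLpNorm_lt_top_iff_lintegral_rpow_enorm_lt_top (μ := μ) (f := f) (p := 2)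
    (by simp) (by simp)
  simp only [ENNReal.toReal_ofNat, ENNReal.rpow_ofNat] at h
  rw [← h]
  exact ⟨fun h => h.2, fun h => ⟨hf, h⟩⟩

/-! ### Mixed second moments of sums over twins. -/

section Marks

variable (lam : Measure ℕ) [IsProbabilityMeasure lam] (π : Measure Path) [IsProbabilityMeasure π]

omit [IsProbabilityMeasure lam] in
lemma memLp_sum_twins (hl : ∫⁻ l, (l : ℝ≥0∞) ^ 2 ∂lam < ∞) {φ : Path → ℝ} (hφ : Measurable φ)
    (hφ2 : MemLp φ 2 π) :
    MemLp (fun m : Mark => ∑ i ∈ Finset.range m.1, φ (m.2 i)) 2 (markLaw lam π) := by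
  rw [memLp_two_iff_lintegral (measurable_sum_twins' hφ).aestronglyMeasurable]
  calc ∫⁻ m : Mark, ‖∑ i ∈ Finset.range m.1, φ (m.2 i)‖ₑ ^ 2 ∂markLaw lam π
      ≤ ∫⁻ m : Mark, (∑ i ∈ Finset.range m.1, ‖φ (m.2 i)‖ₑ) ^ 2 ∂markLaw lam π := by
        gcongr
        exact enorm_sum_le _ _
    _ ≤ (∫⁻ l, (l : ℝ≥0∞) ^ 2 ∂lam) * ∫⁻ z, ‖φ z‖ₑ ^ 2 ∂π :=
        lintegral_sum_twins_sq_le lam π hφ.enorm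
    _ < ∞ := ENNReal.mul_lt_top hl
        ((memLp_two_iff_lintegral hφ.aestronglyMeasurable).1 hφ2)

omit [IsProbabilityMeasure lam] in
lemma memLp_natCast (hl : ∫⁻ l, (l : ℝ≥0∞) ^ 2 ∂lam < ∞) : MemLp (fun l : ℕ => (l : ℝ)) 2 lam := by
  rw [memLp_two_iff_lintegral (by fun_prop)]
  simpa using hl

lemma integral_eval_infinitePi {φ : Path → ℝ} (hφ : Measurable φ) (i : ℕ) :
    ∫ z, φ (z i) ∂Measure.infinitePi (fun _ : ℕ => π) = ∫ z, φ z ∂π := by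
  have h := measurePreserving_eval_infinitePi (fun _ : ℕ => π) i
  refine Eq.trans ?_ (congrArg (fun m => ∫ z, φ z ∂m) h.map_eq)
  exact (integral_map h.measurable.aemeasurable hφ.aestronglyMeasurable).symm

/-- The mixed second moment of two sums over the same twins. -/
lemma integral_sum_twins_mul_sum_twins (hl : ∫⁻ l, (l : ℝ≥0∞) ^ 2 ∂lam < ∞) {φ ψ : Path → ℝ}
    (hφ : Measurable φ) (hψ : Measurable ψ) (hφ2 : MemLp φ 2 π) (hψ2 : MemLp ψ 2 π) :
    ∫ m : Mark, (∑ i ∈ Finset.range m.1, φ (m.2 i)) * (∑ i ∈ Finset.range m.1, ψ (m.2 i))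
        ∂markLaw lam π =
      (∫ l, (l : ℝ) ∂lam) * ∫ z, φ z * ψ z ∂π +
        (∫ l, ((l : ℝ) ^ 2 - l) ∂lam) * (∫ z, φ z ∂π) * ∫ z, ψ z ∂π := by
  set γ := Measure.infinitePi (fun _ : ℕ => π) with hγ
  have hint : Integrable (fun m : Mark => (∑ i ∈ Finset.range m.1, φ (m.2 i)) *
      (∑ i ∈ Finset.range m.1, ψ (m.2 i))) (markLaw lam π) :=
    (memLp_sum_twins lam π hl hφ hφ2).integrable_mul (memLp_sum_twins lam π hl hψ hψ2)
  have hev {χ : Path → ℝ} (h : MemLp χ 2 π) (i : ℕ) : MemLp (fun z : ℕ → Path => χ (z i)) 2 γ :=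
    h.comp_measurePreserving (measurePreserving_eval_infinitePi (fun _ : ℕ => π) i)
  -- Distinct twins are independent. A constant plus a diagonal correction makes the double sum
  -- collapse to the coefficients `l` and `l² - l`.
  have hterm (i j : ℕ) : ∫ z, φ (z i) * ψ (z j) ∂γ =
      (if i = j then ∫ z, φ z * ψ z ∂π - (∫ z, φ z ∂π) * ∫ z, ψ z ∂π else 0) +
        (∫ z, φ z ∂π) * ∫ z, ψ z ∂π := by
    split_ifs with hij
    · subst hij
      rw [sub_add_cancel]
      exact integral_eval_infinitePi π (φ := fun z => φ z * ψ z) (hφ.mul hψ) i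
    · have hind : IndepFun (fun z : ℕ → Path => z i) (fun z => z j) γ :=
        (iIndepFun_infinitePi (P := fun _ : ℕ => π) (X := fun _ z => z)
          fun _ => measurable_id).indepFun hij
      have h2 := (hind.comp hφ hψ).integral_fun_mul_eq_mul_integral
        (hφ.comp (measurable_pi_apply i)).aestronglyMeasurable
        (hψ.comp (measurable_pi_apply j)).aestronglyMeasurable
      simp only [Function.comp_apply] at h2
      rw [zero_add, h2, hγ, integral_eval_infinitePi π hφ, integral_eval_infinitePi π hψ]
  have hfix (l : ℕ) : ∫ z : ℕ → Path, (∑ i ∈ Finset.range l, φ (z i)) *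
      (∑ i ∈ Finset.range l, ψ (z i)) ∂γ = (l : ℝ) * ∫ z, φ z * ψ z ∂π +
        ((l : ℝ) ^ 2 - l) * ((∫ z, φ z ∂π) * ∫ z, ψ z ∂π) := by
    simp_rw [Finset.sum_mul_sum]
    have hi (i j : ℕ) : Integrable (fun z : ℕ → Path => φ (z i) * ψ (z j)) γ :=
      (hev hφ2 i).integrable_mul (hev hψ2 j)
    rw [integral_finsetSum _ fun i _ => integrable_finsetSum _ fun j _ => hi i j]
    simp_rw [integral_finsetSum _ fun j _ => hi _ j, hterm]
    simp_rw [Finset.sum_add_distrib, Finset.sum_ite_eq]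
    rw [Finset.sum_congr rfl (g := fun _ => ∫ z, φ z * ψ z ∂π - (∫ z, φ z ∂π) * ∫ z, ψ z ∂π)
      fun i hi => if_pos hi]
    simp only [Finset.sum_const, Finset.card_range, nsmul_eq_mul]
    ring
  have hL2 := memLp_natCast lam hl
  have hL1 : Integrable (fun l : ℕ => (l : ℝ)) lam := hL2.integrable (by norm_num)
  have hL3 : Integrable (fun l : ℕ => (l : ℝ) ^ 2 - l) lam := hL2.integrable_sq.sub hL1
  rw [markLaw] at hint ⊢
  rw [integral_prod _ hint]
  simp_rw [← hγ, hfix]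
  rw [integral_add (hL1.mul_const _) (hL3.mul_const _), integral_mul_const, integral_mul_const]
  ring

end Marks

/-! ### Covariance structure for a fixed birth rate. -/

section Points

variable (lam : Measure ℕ) [IsProbabilityMeasure lam] (π : Measure Path) [IsProbabilityMeasure π]

lemma integral_birthSet {β : ℝ≥0 → ℝ≥0} (t : ℝ≥0)
    {H : ℝ≥0 × Mark → ℝ}
    (hi : Integrable ((birthSet β t).indicator fun a => H (a.1, a.2.2)) (intensity lam π)) :
    ∫ a, (birthSet β t).indicator (fun a => H (a.1, a.2.2)) a ∂intensity lam π =
      ∫ r in Iic t, β r * ∫ m, H (r, m) ∂markLaw lam π ∂leb := by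
  rw [intensity] at hi ⊢
  rw [integral_prod _ hi, ← integral_indicator measurableSet_Iic]
  refine integral_congr_ae (Eventually.of_forall fun r => ?_)
  dsimp only
  by_cases hr : r ≤ t
  · rw [indicator_of_mem (mem_Iic.2 hr)]
    have e : ∀ p : ℝ≥0 × Mark, (birthSet β t).indicator (fun a => H (a.1, a.2.2)) (r, p) =
        (Iic (β r)).indicator (fun _ => (1 : ℝ)) p.1 * H (r, p.2) := fun p => by
      by_cases hp : p.1 ≤ β r
      · rw [indicator_of_mem (show (r, p) ∈ birthSet β t from ⟨hr, hp⟩),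
          indicator_of_mem (mem_Iic.2 hp), one_mul]
      · rw [indicator_of_notMem (show (r, p) ∉ birthSet β t from fun h => hp h.2),
          indicator_of_notMem (by simpa using hp), zero_mul]
    simp_rw [e]
    rw [integral_prod_mul (f := (Iic (β r)).indicator fun _ => (1 : ℝ)) (g := fun m => H (r, m)),
      integral_indicator measurableSet_Iic]
    simp [Measure.real, leb_Iic]
  · rw [indicator_of_notMem (by simpa using hr)]
    have e : ∀ p : ℝ≥0 × Mark, (birthSet β t).indicator (fun a => H (a.1, a.2.2)) (r, p) = 0 :=
      fun p => indicator_of_notMem (fun h => hr h.1) _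
    simp [e]

/-- The mixed second moment, with respect to the mean measure, of the integrands of
`pointIntegral` at two times. -/
lemma integral_pointFun_mul_pointFun (hl : ∫⁻ l, (l : ℝ≥0∞) ^ 2 ∂lam < ∞) {β : ℝ≥0 → ℝ≥0}
    {t s : ℝ≥0} (hπ : ∀ r ≤ max t s, MemLp (fun z : Path => z.1 r) 2 π)
    (ht : MemLp (pointFun β t) 2 (intensity lam π))
    (hs : MemLp (pointFun β s) 2 (intensity lam π)) :
    ∫ a, pointFun β t a * pointFun β s a ∂intensity lam π =
      ∫ r in Iic (min t s), β r * (meanTwins lam * ∫ z, z.1 (t - r) * z.1 (s - r) ∂π +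
            (∫ l, ((l : ℝ) ^ 2 - l) ∂lam) * meanPop π (t - r) * meanPop π (s - r)) ∂leb := by
  let H : ℝ≥0 × Mark → ℝ := fun p => (∑ i ∈ Finset.range p.2.1, (p.2.2 i).1 (t - p.1)) *
    ∑ i ∈ Finset.range p.2.1, (p.2.2 i).1 (s - p.1)
  have e : (fun a => pointFun β t a * pointFun β s a) =
      (birthSet β (min t s)).indicator fun a => H (a.1, a.2.2) := by
    have : birthSet β (min t s) = birthSet β t ∩ birthSet β s := by
      ext a
      simp only [birthSet, mem_ofPred_eq, mem_inter_iff, le_min_iff]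
      tauto
    rw [this]
    ext a
    exact (inter_indicator_mul _ _ a).symm
  have hi : Integrable (fun a => pointFun β t a * pointFun β s a) (intensity lam π) :=
    ht.integrable_mul hs
  rw [e] at hi ⊢
  rw [integral_birthSet lam π _ hi]
  refine setIntegral_congr_fun measurableSet_Iic fun r _ => ?_
  dsimp only [H]
  rw [integral_sum_twins_mul_sum_twins lam π hl (φ := fun z => z.1 (t - r))
    (ψ := fun z => z.1 (s - r)) (measurable_eval_path _) (measurable_eval_path _)
    (hπ _ (tsub_le_self.trans (le_max_left _ _))) (hπ _ (tsub_le_self.trans (le_max_right _ _)))]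
  rfl

end Points

/-! ### Fubini for products of time integrals. -/

section Fubini

variable {S B : Type*} [MeasurableSpace S] [MeasurableSpace B] {ν : Measure S}
  [IsProbabilityMeasure ν] {β : Measure B} [IsFiniteMeasure β] {d : B × S → ℝ}

omit [IsProbabilityMeasure ν] in
lemma memLp_integral_left [SFinite ν] (hd : Measurable d) (hd2 : MemLp d 2 (β.prod ν)) :
    MemLp (fun x => ∫ b, d (b, x) ∂β) 2 ν := by
  have hm : StronglyMeasurable fun x => ∫ b, d (b, x) ∂β :=
    (hd.comp measurable_swap).stronglyMeasurable.integral_prod_right' (f := fun p : S × B => d (p.2, p.1))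
  rw [memLp_two_iff_lintegral hm.aestronglyMeasurable]
  calc ∫⁻ x, ‖∫ b, d (b, x) ∂β‖ₑ ^ 2 ∂ν ≤ ∫⁻ x, β univ * ∫⁻ b, ‖d (b, x)‖ₑ ^ 2 ∂β ∂ν := by
        gcongr with x
        refine (pow_le_pow_left' (enorm_integral_le_lintegral_enorm _) 2).trans
          (sq_lintegral_le _ ?_)
        exact (hd.comp measurable_prodMk_right).enorm.aemeasurable
    _ = β univ * ∫⁻ p, ‖d p‖ₑ ^ 2 ∂β.prod ν := by
        rw [lintegral_const_mul' _ _ (measure_ne_top _ _),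
          lintegral_prod_symm _ (hd.enorm.pow_const 2).aemeasurable]
    _ < ∞ := ENNReal.mul_lt_top (measure_lt_top _ _)
        ((memLp_two_iff_lintegral hd.aestronglyMeasurable).1 hd2)

omit [IsFiniteMeasure β] in
lemma ae_memLp_section (hd : Measurable d) (hd2 : MemLp d 2 (β.prod ν)) :
    ∀ᵐ b ∂β, MemLp (fun x => d (b, x)) 2 ν := by
  have h := (memLp_two_iff_lintegral hd.aestronglyMeasurable).1 hd2
  rw [lintegral_prod _ (hd.enorm.pow_const 2).aemeasurable] at h
  filter_upwards [ae_lt_top (hd.enorm.pow_const 2).lintegral_prod_right' h.ne] with b hb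
  exact (memLp_two_iff_lintegral (hd.comp measurable_prodMk_left).aestronglyMeasurable).2 hb

lemma integral_mul_integral_left {f : S → ℝ} (hf : MemLp f 2 ν) (hd2 : MemLp d 2 (β.prod ν)) :
    ∫ x, f x * ∫ b, d (b, x) ∂β ∂ν = ∫ b, ∫ x, f x * d (b, x) ∂ν ∂β := by
  have hi : Integrable (Function.uncurry fun b x => f x * d (b, x)) (β.prod ν) :=
    (hf.comp_snd β).integrable_mul hd2
  rw [integral_integral_swap hi]
  simp_rw [integral_const_mul]

/-- The one-integral case is applied twice, the second time for almost every `a`, where the section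
of `c` is square integrable. -/
lemma integral_left_mul_integral_left {A : Type*} [MeasurableSpace A] {α : Measure A}
    [IsFiniteMeasure α] {c : A × S → ℝ} (hc : Measurable c) (hc2 : MemLp c 2 (α.prod ν))
    (hd : Measurable d) (hd2 : MemLp d 2 (β.prod ν)) :
    ∫ x, (∫ a, c (a, x) ∂α) * ∫ b, d (b, x) ∂β ∂ν =
      ∫ a, ∫ b, ∫ x, c (a, x) * d (b, x) ∂ν ∂β ∂α := by
  simp_rw [mul_comm (∫ a, c (a, _) ∂α)]
  rw [integral_mul_integral_left (memLp_integral_left hd hd2) hc2]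
  refine integral_congr_ae ?_
  filter_upwards [ae_memLp_section hc hc2] with a ha
  rw [← integral_mul_integral_left ha hd2]
  simp_rw [mul_comm]

end Fubini

lemma abs_integral_mul_le {α : Type*} [MeasurableSpace α] {μ : Measure α} {f g : α → ℝ} {C : ℝ}
    (hf : MemLp f 2 μ) (hg : MemLp g 2 μ) (hfC : ∫ a, f a ^ 2 ∂μ ≤ C) (hgC : ∫ a, g a ^ 2 ∂μ ≤ C) :
    |∫ a, f a * g a ∂μ| ≤ C := by
  have h1 := hf.integrable_sq
  have h2 := hg.integrable_sq
  have h3 : Integrable (fun a => f a * g a) μ := hf.integrable_mul hg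
  have h4 : ∫ a, |f a * g a| ∂μ ≤ ∫ a, (f a ^ 2 / 2 + g a ^ 2 / 2) ∂μ :=
    integral_mono h3.abs ((h1.div_const 2).add (h2.div_const 2)) fun a => by
      dsimp only
      rw [abs_mul, ← sq_abs (f a), ← sq_abs (g a)]
      nlinarith [sq_nonneg (|f a| - |g a|)]
  rw [integral_add (h1.div_const 2) (h2.div_const 2), integral_div, integral_div] at h4
  linarith [abs_integral_le_integral_abs (f := fun a => f a * g a) (μ := μ)]

/-- The paths have second moments bounded by `C` up to time `T`. -/
structure HasMomentBound (π : Measure Path) (T : ℝ≥0) (C : ℝ) : Prop where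
  memLp : ∀ t ≤ T, MemLp (fun z : Path => z.1 t) 2 π
  one_le : 1 ≤ C
  bound : ∀ t ≤ T, ∫ z, z.1 t ^ 2 ∂π ≤ C

namespace HasMomentBound

variable {π : Measure Path} [IsProbabilityMeasure π] {T : ℝ≥0} {C : ℝ}

lemma abs_meanPop_le (h : HasMomentBound π T C) {t : ℝ≥0} (ht : t ≤ T) : |meanPop π t| ≤ C := by
  -- The path is paired with the constant `1`, whose second moment is at most `C` by `one_le`.
  have := abs_integral_mul_le (h.memLp t ht) (memLp_const (1 : ℝ)) (h.bound t ht)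
    (by simpa using h.one_le)
  simpa [meanPop] using this

omit [IsProbabilityMeasure π] in
lemma abs_integral_mul_le (h : HasMomentBound π T C) {t s : ℝ≥0} (ht : t ≤ T) (hs : s ≤ T) :
    |∫ z, z.1 t * z.1 s ∂π| ≤ C :=
  CMJ.abs_integral_mul_le (h.memLp t ht) (h.memLp s hs) (h.bound t ht) (h.bound s hs)

omit [IsProbabilityMeasure π] in
lemma lintegral_sq_le (h : HasMomentBound π T C) {t : ℝ≥0} (ht : t ≤ T) :
    ∫⁻ z, ‖z.1 t‖ₑ ^ 2 ∂π ≤ ENNReal.ofReal C := by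
  have h1 := h.bound t ht
  refine le_trans (le_of_eq ?_) (ENNReal.ofReal_le_ofReal h1)
  rw [ofReal_integral_eq_lintegral_ofReal (h.memLp t ht).integrable_sq
    (Eventually.of_forall fun z => sq_nonneg _)]
  refine lintegral_congr fun z => ?_
  rw [← sq_abs, ENNReal.ofReal_pow (abs_nonneg _), Real.enorm_eq_ofReal_abs]

end HasMomentBound

lemma measurable_meanPop (π : Measure Path) [IsProbabilityMeasure π] : Measurable (meanPop π) :=
  (measurable_eval.stronglyMeasurable.integral_prod_right' (f := fun p : ℝ≥0 × Path =>
    p.2.1 p.1)).measurable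

/-! ### Contributions of a single ancestor. -/

section Deviations

variable {S : Type*} [MeasurableSpace S] (ν : Measure S) (b : ℝ≥0 → S → ℝ≥0) (η : S → ℝ≥0)
  (lam : Measure ℕ) (π : Measure Path)

/-- The contribution of one ancestor to `U₁`. -/
def lifetimeDev (t : ℝ≥0) (x : S) : ℝ := (if t < η x then (1 : ℝ) else 0) - survival ν η t

/-- The integrand of the contribution of one ancestor to `U₂`. -/
def rateFun (t : ℝ≥0) (p : ℝ≥0 × S) : ℝ :=
  ((b p.1 p.2 : ℝ) - meanRate ν b p.1) * meanTwins lam * meanPop π (t - p.1)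

/-- The contribution of one ancestor to `U₂`. -/
def rateDev (t : ℝ≥0) (x : S) : ℝ := ∫ s in Iic t, rateFun ν b lam π t (s, x) ∂leb

/-- The contribution of one ancestor to `U₃`. -/
def birthDev (t : ℝ≥0) (y : S × Measure Point) : ℝ :=
  pointIntegral (fun s => b s y.1) t y.2 - pointIntegral (fun s => b s y.1) t (intensity lam π)

end Deviations

/-! ### Moments of the lifetime contribution. -/

section Lifetime

variable {S : Type*} [MeasurableSpace S] {ν : Measure S} [IsProbabilityMeasure ν] {η : S → ℝ≥0}

omit [IsProbabilityMeasure ν] in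
lemma integral_ite_lt (hη : Measurable η) (t : ℝ≥0) :
    ∫ x, (if t < η x then (1 : ℝ) else 0) ∂ν = survival ν η t := by
  have hA : MeasurableSet {x | t < η x} := measurableSet_lt measurable_const hη
  rw [survival, ← integral_indicator_one hA]
  rfl

lemma memLp_ite_lt (hη : Measurable η) (t : ℝ≥0) :
    MemLp (fun x => if t < η x then (1 : ℝ) else 0) 2 ν := by
  have hA : MeasurableSet {x | t < η x} := measurableSet_lt measurable_const hη
  exact (memLp_const (1 : ℝ)).indicator hA

lemma memLp_lifetimeDev (hη : Measurable η) (t : ℝ≥0) : MemLp (lifetimeDev ν η t) 2 ν :=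
  (memLp_ite_lt hη t).sub (memLp_const _)

lemma integral_lifetimeDev (hη : Measurable η) (t : ℝ≥0) : ∫ x, lifetimeDev ν η t x ∂ν = 0 := by
  unfold lifetimeDev
  rw [integral_sub ((memLp_ite_lt hη t).integrable (by norm_num)) (integrable_const _),
    integral_ite_lt hη]
  simp

lemma integral_lifetimeDev_mul_lifetimeDev (hη : Measurable η) (t s : ℝ≥0) :
    ∫ x, lifetimeDev ν η t x * lifetimeDev ν η s x ∂ν =
      survival ν η (max t s) - survival ν η t * survival ν η s := by
  have hi (t : ℝ≥0) : Integrable (fun x => if t < η x then (1 : ℝ) else 0) ν :=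
    (memLp_ite_lt hη t).integrable (by norm_num)
  -- The product of indicators is the indicator at `max t s`; the terms are grouped so that the last
  -- one is centered.
  have e (x : S) : lifetimeDev ν η t x * lifetimeDev ν η s x =
      (if max t s < η x then (1 : ℝ) else 0) - survival ν η t * (if s < η x then (1 : ℝ) else 0) -
        survival ν η s * lifetimeDev ν η t x := by
    simp only [lifetimeDev, max_lt_iff]
    by_cases h1 : t < η x <;> by_cases h2 : s < η x <;> simp [h1, h2] <;> ring
  have hi' : Integrable (fun x => (if max t s < η x then (1 : ℝ) else 0) -
      survival ν η t * (if s < η x then (1 : ℝ) else 0)) ν := (hi _).sub ((hi _).const_mul _)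
  simp_rw [e]
  rw [integral_sub hi'
    (((memLp_lifetimeDev hη t).integrable (by norm_num)).const_mul _),
    integral_sub (hi _) ((hi _).const_mul _), integral_const_mul, integral_const_mul,
    integral_ite_lt hη, integral_ite_lt hη, integral_lifetimeDev hη]
  ring

end Lifetime

/-! ### Moments of the birth rate contribution. -/

section Rate

variable {S : Type*} [MeasurableSpace S] {ν : Measure S} [IsProbabilityMeasure ν]
  {b : ℝ≥0 → S → ℝ≥0} {η : S → ℝ≥0} {lam : Measure ℕ} {π : Measure Path} [IsProbabilityMeasure π]

lemma measurable_meanRate (hb : Measurable (Function.uncurry b)) : Measurable (meanRate ν b) := by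
  have h : Measurable fun p : ℝ≥0 × S => (b p.1 p.2 : ℝ) := NNReal.continuous_coe.measurable.comp hb
  exact (h.stronglyMeasurable.integral_prod_right' (f := fun p : ℝ≥0 × S => (b p.1 p.2 : ℝ))).measurable

lemma measurable_rateFun (hb : Measurable (Function.uncurry b)) (t : ℝ≥0) :
    Measurable (rateFun ν b lam π t) := by
  have h : Measurable fun p : ℝ≥0 × S => (b p.1 p.2 : ℝ) := NNReal.continuous_coe.measurable.comp hb
  exact ((h.sub ((measurable_meanRate hb).comp measurable_fst)).mul_const _).mul
    ((measurable_meanPop π).comp (measurable_const.sub measurable_fst))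

omit [IsProbabilityMeasure ν] in
lemma ae_memLp_rate (hb : Measurable (Function.uncurry b)) {T B : ℝ≥0}
    (hB : ∀ t, t ≠ 0 → t ≤ T → ∫⁻ y, (b t y : ℝ≥0∞) ^ 2 ∂ν ≤ B) {t : ℝ≥0} (ht : t ≤ T) :
    ∀ᵐ s ∂leb.restrict (Iic t), MemLp (fun x => (b s x : ℝ)) 2 ν := by
  filter_upwards [ae_restrict_of_ae ae_leb_ne_zero, ae_restrict_mem measurableSet_Iic] with s h0 hs
  have h : Measurable fun x => (b s x : ℝ) :=
    NNReal.continuous_coe.measurable.comp (measurable_rate_right hb s)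
  rw [memLp_two_iff_lintegral h.aestronglyMeasurable]
  refine lt_of_le_of_lt ?_ (ENNReal.coe_lt_top (r := B))
  simpa using hB s h0 ((mem_Iic.1 hs).trans ht)

lemma memLp_rate (hb : Measurable (Function.uncurry b)) {T B : ℝ≥0}
    (hB : ∀ t, t ≠ 0 → t ≤ T → ∫⁻ y, (b t y : ℝ≥0∞) ^ 2 ∂ν ≤ B) {t : ℝ≥0} (ht : t ≤ T) :
    MemLp (fun p : ℝ≥0 × S => (b p.1 p.2 : ℝ)) 2 ((leb.restrict (Iic t)).prod ν) := by
  have h : Measurable fun p : ℝ≥0 × S => (b p.1 p.2 : ℝ) := NNReal.continuous_coe.measurable.comp hb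
  rw [memLp_two_iff_lintegral h.aestronglyMeasurable,
    lintegral_prod _ (h.enorm.pow_const 2).aemeasurable]
  calc ∫⁻ s in Iic t, ∫⁻ x, ‖(b s x : ℝ)‖ₑ ^ 2 ∂ν ∂leb ≤ ∫⁻ _ in Iic t, B ∂leb := by
        refine lintegral_mono_ae ?_
        filter_upwards [ae_restrict_of_ae ae_leb_ne_zero, ae_restrict_mem measurableSet_Iic]
          with s h0 hs
        simpa using hB s h0 ((mem_Iic.1 hs).trans ht)
    _ < ∞ := by
        rw [lintegral_const]
        exact ENNReal.mul_lt_top ENNReal.coe_lt_top (measure_lt_top _ _)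

lemma memLp_meanRate (hb : Measurable (Function.uncurry b)) {T B : ℝ≥0}
    (hB : ∀ t, t ≠ 0 → t ≤ T → ∫⁻ y, (b t y : ℝ≥0∞) ^ 2 ∂ν ≤ B) {t : ℝ≥0} (ht : t ≤ T) :
    MemLp (meanRate ν b) 2 (leb.restrict (Iic t)) := by
  have h : Measurable fun p : ℝ≥0 × S => (b p.1 p.2 : ℝ) := NNReal.continuous_coe.measurable.comp hb
  exact memLp_integral_left (d := fun p : S × ℝ≥0 => (b p.2 p.1 : ℝ)) (h.comp measurable_swap)
    ((memLp_rate hb hB ht).comp_measurePreserving Measure.measurePreserving_swap)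

lemma memLp_rateFun (hb : Measurable (Function.uncurry b)) {T B : ℝ≥0}
    (hB : ∀ t, t ≠ 0 → t ≤ T → ∫⁻ y, (b t y : ℝ≥0∞) ^ 2 ∂ν ≤ B) {C : ℝ}
    (hπ : HasMomentBound π T C) {t : ℝ≥0} (ht : t ≤ T) :
    MemLp (rateFun ν b lam π t) 2 ((leb.restrict (Iic t)).prod ν) := by
  refine (((memLp_rate hb hB ht).sub ((memLp_meanRate hb hB ht).comp_fst ν)).const_mul
    (|meanTwins lam| * C)).mono (measurable_rateFun hb t).aestronglyMeasurable
    (Eventually.of_forall fun p => ?_)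
  have hC : 0 ≤ C := zero_le_one.trans hπ.one_le
  simp only [rateFun, Pi.sub_apply, Real.norm_eq_abs, abs_mul, abs_abs, abs_of_nonneg hC]
  rw [mul_assoc, mul_comm]
  gcongr
  exact hπ.abs_meanPop_le (tsub_le_self.trans ht)

lemma memLp_rateDev (hb : Measurable (Function.uncurry b)) {T B : ℝ≥0}
    (hB : ∀ t, t ≠ 0 → t ≤ T → ∫⁻ y, (b t y : ℝ≥0∞) ^ 2 ∂ν ≤ B) {C : ℝ}
    (hπ : HasMomentBound π T C) {t : ℝ≥0} (ht : t ≤ T) : MemLp (rateDev ν b lam π t) 2 ν :=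
  memLp_integral_left (measurable_rateFun hb t) (memLp_rateFun hb hB hπ ht)

lemma integral_rateDev (hb : Measurable (Function.uncurry b)) {T B : ℝ≥0}
    (hB : ∀ t, t ≠ 0 → t ≤ T → ∫⁻ y, (b t y : ℝ≥0∞) ^ 2 ∂ν ≤ B) {C : ℝ}
    (hπ : HasMomentBound π T C) {t : ℝ≥0} (ht : t ≤ T) :
    ∫ x, rateDev ν b lam π t x ∂ν = 0 := by
  -- Fubini with the factor `1`: the integrand is centered at almost every time.
  have h1 := integral_mul_integral_left (memLp_const (1 : ℝ))
    (memLp_rateFun (ν := ν) (lam := lam) hb hB hπ ht)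
  simp only [one_mul] at h1
  refine h1.trans (integral_eq_zero_of_ae ?_)
  filter_upwards [ae_memLp_rate hb hB ht] with s hs
  simp only [rateFun]
  rw [integral_mul_const, integral_mul_const,
    integral_sub (hs.integrable (by norm_num)) (integrable_const _)]
  simp [meanRate]

lemma integral_rateDev_mul_rateDev (hb : Measurable (Function.uncurry b)) {T B : ℝ≥0}
    (hB : ∀ t, t ≠ 0 → t ≤ T → ∫⁻ y, (b t y : ℝ≥0∞) ^ 2 ∂ν ≤ B) {C : ℝ}
    (hπ : HasMomentBound π T C) {t s : ℝ≥0} (ht : t ≤ T) (hs : s ≤ T) :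
    ∫ x, rateDev ν b lam π t x * rateDev ν b lam π s x ∂ν =
      ∫ r in Iic t, ∫ v in Iic s, meanTwins lam ^ 2 * meanPop π (t - r) * meanPop π (s - v) *
        cov[fun y => (b r y : ℝ), fun y => (b v y : ℝ); ν] ∂leb ∂leb := by
  unfold rateDev
  rw [integral_left_mul_integral_left (measurable_rateFun hb t) (memLp_rateFun hb hB hπ ht)
    (measurable_rateFun hb s) (memLp_rateFun hb hB hπ hs)]
  refine integral_congr_ae (Eventually.of_forall fun r => integral_congr_ae
    (Eventually.of_forall fun v => ?_))
  simp only [covariance, ← integral_const_mul]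
  refine integral_congr_ae (Eventually.of_forall fun x => ?_)
  simp only [rateFun, meanRate]
  ring

lemma integral_lifetimeDev_mul_rateDev (hb : Measurable (Function.uncurry b)) (hη : Measurable η)
    {T B : ℝ≥0} (hB : ∀ t, t ≠ 0 → t ≤ T → ∫⁻ y, (b t y : ℝ≥0∞) ^ 2 ∂ν ≤ B) {C : ℝ}
    (hπ : HasMomentBound π T C) (t : ℝ≥0) {s : ℝ≥0} (hs : s ≤ T) :
    ∫ x, lifetimeDev ν η t x * rateDev ν b lam π s x ∂ν =
      ∫ r in Iic s, meanTwins lam * meanPop π (s - r) *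
        cov[fun y => (b r y : ℝ), fun y => if t < η y then (1 : ℝ) else 0; ν] ∂leb := by
  unfold rateDev
  rw [integral_mul_integral_left (memLp_lifetimeDev hη t) (memLp_rateFun hb hB hπ hs)]
  refine integral_congr_ae (Eventually.of_forall fun r => ?_)
  simp only [covariance, ← integral_const_mul]
  refine integral_congr_ae (Eventually.of_forall fun x => ?_)
  simp only [rateFun, meanRate, lifetimeDev, integral_ite_lt hη]
  ring

end Rate

/-! ### Compensated Poisson integrals given the type. -/

section Mixed

variable {S E : Type*} [MeasurableSpace S] [MeasurableSpace E] {ν : Measure S}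
  [IsProbabilityMeasure ν] {μ : Measure E} [SigmaFinite μ] {Q : Measure (Measure E)}
  [IsProbabilityMeasure Q] {F G : S → E → ℝ}

omit [IsProbabilityMeasure ν] in
lemma ae_integrable_memLp (hF : Measurable (Function.uncurry F))
    (hF2 : ∫⁻ x, ∫⁻ a, ‖F x a‖ₑ ^ 2 ∂μ + (∫⁻ a, ‖F x a‖ₑ ∂μ) ^ 2 ∂ν < ∞) :
    ∀ᵐ x ∂ν, Integrable (F x) μ ∧ MemLp (F x) 2 μ := by
  have h1 : Measurable fun x => ∫⁻ a, ‖F x a‖ₑ ^ 2 ∂μ :=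
    (hF.enorm.pow_const 2).lintegral_prod_right'
  have h2 : Measurable fun x => ∫⁻ a, ‖F x a‖ₑ ∂μ := hF.enorm.lintegral_prod_right'
  filter_upwards [ae_lt_top (h1.add (h2.pow_const 2)) hF2.ne] with x hx
  have hFx : AEStronglyMeasurable (F x) μ := (hF.of_uncurry_left).aestronglyMeasurable
  have h3 := ENNReal.add_lt_top.1 hx
  exact ⟨⟨hFx, (ENNReal.pow_lt_top_iff.1 h3.2).resolve_right (by norm_num)⟩,
    (memLp_two_iff_lintegral hFx).2 h3.1⟩

namespace IsPoissonRandomMeasure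

/-- The compensated integral of a random function is square integrable. -/
lemma memLp_prod (hQ : IsPoissonRandomMeasure id μ Q) (hF : Measurable (Function.uncurry F))
    (hF2 : ∫⁻ x, ∫⁻ a, ‖F x a‖ₑ ^ 2 ∂μ + (∫⁻ a, ‖F x a‖ₑ ∂μ) ^ 2 ∂ν < ∞) :
    MemLp (fun p : S × Measure E => ∫ a, F p.1 a ∂p.2 - ∫ a, F p.1 a ∂μ) 2 (ν.prod Q) := by
  have h1 := stronglyMeasurable_integral_idKernel μ hF
  have h2 : StronglyMeasurable fun x => ∫ a, F x a ∂μ :=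
    hF.stronglyMeasurable.integral_prod_right
  have m1 : MemLp (fun p : S × Measure E => ∫ a, F p.1 a ∂idKernel μ p.2) 2 (ν.prod Q) := by
    rw [memLp_two_iff_lintegral h1.aestronglyMeasurable]
    calc ∫⁻ p : S × Measure E, ‖∫ a, F p.1 a ∂idKernel μ p.2‖ₑ ^ 2 ∂ν.prod Q
        ≤ ∫⁻ p : S × Measure E, (∫⁻ a, ‖F p.1 a‖ₑ ∂idKernel μ p.2) ^ 2 ∂ν.prod Q := by
          gcongr
          exact enorm_integral_le_lintegral_enorm _
      _ < ∞ := by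
          rw [hQ.lintegral_prod_sq (F := fun x a => ‖F x a‖ₑ) hF.enorm]
          exact hF2
  have m2 : MemLp (fun x => ∫ a, F x a ∂μ) 2 ν := by
    rw [memLp_two_iff_lintegral h2.aestronglyMeasurable]
    refine lt_of_le_of_lt (lintegral_mono fun x => ?_) hF2
    exact (pow_le_pow_left' (enorm_integral_le_lintegral_enorm _) 2).trans le_add_self
  -- Joint measurability holds for the kernel version, which agrees almost everywhere with the
  -- integral against `p.2`.
  refine (m1.sub (m2.comp_fst Q)).ae_eq ?_
  filter_upwards [hQ.ae_prod_idKernel_eq (ν := ν)] with p hp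
  simp only [Pi.sub_apply, hp]

/-- A compensated integral is centered, conditionally on the integrand. -/
lemma integral_fst_mul_prod (hQ : IsPoissonRandomMeasure id μ Q)
    (hF : Measurable (Function.uncurry F))
    (hF2 : ∫⁻ x, ∫⁻ a, ‖F x a‖ₑ ^ 2 ∂μ + (∫⁻ a, ‖F x a‖ₑ ∂μ) ^ 2 ∂ν < ∞) {f : S → ℝ}
    (hf : MemLp f 2 ν) :
    ∫ p : S × Measure E, f p.1 * (∫ a, F p.1 a ∂p.2 - ∫ a, F p.1 a ∂μ) ∂ν.prod Q = 0 := by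
  have hi : Integrable (fun p : S × Measure E =>
      f p.1 * (∫ a, F p.1 a ∂p.2 - ∫ a, F p.1 a ∂μ)) (ν.prod Q) :=
    (hf.comp_fst Q).integrable_mul (hQ.memLp_prod hF hF2)
  rw [integral_prod _ hi]
  refine integral_eq_zero_of_ae ?_
  filter_upwards [ae_integrable_memLp hF hF2] with x hx
  have hFx : Measurable (F x) := hF.of_uncurry_left
  have h1 := hQ.integral_integral hFx hx.1
  have h2 := (hQ.memLp_integral hFx hx.1 hx.2).integrable (by norm_num)
  simp only [id] at h1 h2
  rw [integral_const_mul, integral_sub h2 (integrable_const _), h1]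
  simp

/-- The covariance of compensated integrals of random functions. -/
lemma integral_prod_mul_prod (hQ : IsPoissonRandomMeasure id μ Q)
    (hF : Measurable (Function.uncurry F))
    (hF2 : ∫⁻ x, ∫⁻ a, ‖F x a‖ₑ ^ 2 ∂μ + (∫⁻ a, ‖F x a‖ₑ ∂μ) ^ 2 ∂ν < ∞)
    (hG : Measurable (Function.uncurry G))
    (hG2 : ∫⁻ x, ∫⁻ a, ‖G x a‖ₑ ^ 2 ∂μ + (∫⁻ a, ‖G x a‖ₑ ∂μ) ^ 2 ∂ν < ∞) :
    ∫ p : S × Measure E, (∫ a, F p.1 a ∂p.2 - ∫ a, F p.1 a ∂μ) *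
        (∫ a, G p.1 a ∂p.2 - ∫ a, G p.1 a ∂μ) ∂ν.prod Q =
      ∫ x, ∫ a, F x a * G x a ∂μ ∂ν := by
  have hi : Integrable (fun p : S × Measure E => (∫ a, F p.1 a ∂p.2 - ∫ a, F p.1 a ∂μ) *
      (∫ a, G p.1 a ∂p.2 - ∫ a, G p.1 a ∂μ)) (ν.prod Q) :=
    (hQ.memLp_prod hF hF2).integrable_mul (hQ.memLp_prod hG hG2)
  rw [integral_prod _ hi]
  refine integral_congr_ae ?_
  filter_upwards [ae_integrable_memLp hF hF2, ae_integrable_memLp hG hG2] with x hx hx'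
  have hFx : Measurable (F x) := hF.of_uncurry_left
  have hGx : Measurable (G x) := hG.of_uncurry_left
  have h1 := hQ.integral_integral hFx hx.1
  have h2 := hQ.memLp_integral hFx hx.1 hx.2
  have h1' := hQ.integral_integral hGx hx'.1
  have h2' := hQ.memLp_integral hGx hx'.1 hx'.2
  have h3 := hQ.integral_integral_mul_integral hFx hGx hx.1 hx'.1 hx.2 hx'.2
  simp only [id] at h1 h2 h1' h2' h3
  -- Centering removes the product of the means from the second moment and leaves `∫ F G dμ`.
  rw [integral_sub_mul_sub h2 (memLp_const _) h2' (memLp_const _), h3, integral_mul_const,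
    integral_const_mul, h1, h1']
  simp

end IsPoissonRandomMeasure

end Mixed

/-! ### Moments of the compensated birth contribution. -/

section Birth

variable {S : Type*} [MeasurableSpace S] {ν : Measure S} [IsProbabilityMeasure ν]
  {b : ℝ≥0 → S → ℝ≥0} {lam : Measure ℕ} [IsProbabilityMeasure lam]
  {π : Measure Path} [IsProbabilityMeasure π] {T B : ℝ≥0} {C : ℝ}

omit [IsProbabilityMeasure ν] [IsProbabilityMeasure lam] [IsProbabilityMeasure π] in
lemma measurable_uncurry_pointFun (hb : Measurable (Function.uncurry b)) (t : ℝ≥0) :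
    Measurable (Function.uncurry fun (x : S) (a : Point) => pointFun (fun s => b s x) t a) :=
  measurable_pointFun hb t

lemma lintegral_pointFun_lt_top (hb : Measurable (Function.uncurry b))
    (hl : ∫⁻ l, (l : ℝ≥0∞) ^ 2 ∂lam < ∞)
    (hB : ∀ t, t ≠ 0 → t ≤ T → ∫⁻ y, (b t y : ℝ≥0∞) ^ 2 ∂ν ≤ B)
    (hπ : HasMomentBound π T C) {t : ℝ≥0} (ht : t ≤ T) :
    ∫⁻ x, ∫⁻ a, ‖pointFun (fun s => b s x) t a‖ₑ ^ 2 ∂intensity lam π +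
      (∫⁻ a, ‖pointFun (fun s => b s x) t a‖ₑ ∂intensity lam π) ^ 2 ∂ν < ∞ := by
  have hw : Measurable fun p : ℝ≥0 × Path => ‖p.2.1 (t - p.1)‖ₑ := (measurable_eval_sub t).enorm
  have hm : Measurable fun r : ℝ≥0 => ∫⁻ z : Path, ‖z.1 (t - r)‖ₑ ^ 2 ∂π :=
    (hw.pow_const 2).lintegral_prod_right'
  calc ∫⁻ x, ∫⁻ a, ‖pointFun (fun s => b s x) t a‖ₑ ^ 2 ∂intensity lam π +
        (∫⁻ a, ‖pointFun (fun s => b s x) t a‖ₑ ∂intensity lam π) ^ 2 ∂ν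
      ≤ ∫⁻ x, (∫⁻ l, (l : ℝ≥0∞) ^ 2 ∂lam) * ∫⁻ r in Iic t,
          (b r x + t * (b r x : ℝ≥0∞) ^ 2) * ∫⁻ z, ‖z.1 (t - r)‖ₑ ^ 2 ∂π ∂leb ∂ν := by
        refine lintegral_mono fun x => ?_
        refine lintegral_sq_add_sq_lintegral_le lam π (measurable_rate_left hb x) t hw fun a => ?_
        simp only [pointFun]
        by_cases ha : a ∈ birthSet (fun s => b s x) t
        · rw [indicator_of_mem ha, indicator_of_mem ha]
          exact enorm_sum_le _ _
        · rw [indicator_of_notMem ha]; simp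
    _ ≤ (∫⁻ l, (l : ℝ≥0∞) ^ 2 ∂lam) * ((1 + B + T * B) *
          ∫⁻ r in Iic t, ∫⁻ z, ‖z.1 (t - r)‖ₑ ^ 2 ∂π ∂leb) := by
        rw [lintegral_const_mul' _ _ hl.ne]
        gcongr
        exact lintegral_rate_mul_le hb hB ht hm
    _ ≤ (∫⁻ l, (l : ℝ≥0∞) ^ 2 ∂lam) * ((1 + B + T * B) *
          ∫⁻ _ in Iic t, ENNReal.ofReal C ∂leb) := by
        gcongr with r
        exact hπ.lintegral_sq_le (tsub_le_self.trans ht)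
    _ < ∞ := by
        rw [lintegral_const]
        refine ENNReal.mul_lt_top hl (ENNReal.mul_lt_top ?_
          (ENNReal.mul_lt_top ENNReal.ofReal_lt_top (measure_lt_top _ _)))
        exact_mod_cast ENNReal.coe_lt_top (r := 1 + B + T * B)

omit [IsProbabilityMeasure lam] [IsProbabilityMeasure π] in
lemma birthDev_eq (hb : Measurable (Function.uncurry b)) (t : ℝ≥0) :
    birthDev b lam π t = fun p : S × Measure Point =>
      ∫ a, pointFun (fun s => b s p.1) t a ∂p.2 -
        ∫ a, pointFun (fun s => b s p.1) t a ∂intensity lam π := by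
  ext p
  rw [birthDev, pointIntegral_eq (measurable_rate_left hb _),
    pointIntegral_eq (measurable_rate_left hb _)]

lemma integral_rate_mul (hb : Measurable (Function.uncurry b))
    (hB : ∀ t, t ≠ 0 → t ≤ T → ∫⁻ y, (b t y : ℝ≥0∞) ^ 2 ∂ν ≤ B) {t : ℝ≥0} (ht : t ≤ T)
    {g : ℝ≥0 → ℝ} (hg : Measurable g) {K : ℝ} (hK : ∀ r ≤ t, |g r| ≤ K) :
    ∫ x, ∫ r in Iic t, b r x * g r ∂leb ∂ν = ∫ r in Iic t, meanRate ν b r * g r ∂leb := by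
  have h1 : Integrable (fun p : ℝ≥0 × S => (b p.1 p.2 : ℝ)) ((leb.restrict (Iic t)).prod ν) :=
    (memLp_rate hb hB ht).integrable (by norm_num)
  have h2 : Integrable (fun p : ℝ≥0 × S => g p.1 * b p.1 p.2) ((leb.restrict (Iic t)).prod ν) := by
    refine h1.bdd_mul (c := K) (hg.comp measurable_fst).aestronglyMeasurable ?_
    exact Measure.quasiMeasurePreserving_fst.ae (p := fun r => ‖g r‖ ≤ K)
      ((ae_restrict_mem measurableSet_Iic).mono fun r hr => hK r hr)
  have h3 : Integrable (Function.uncurry fun (x : S) (r : ℝ≥0) => (b r x : ℝ) * g r)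
      (ν.prod (leb.restrict (Iic t))) := by
    refine (h2.swap).congr (Eventually.of_forall fun p => ?_)
    simp [Function.uncurry, mul_comm]
  rw [integral_integral_swap h3]
  simp_rw [integral_mul_const]
  rfl

/-- Given the type, the Poisson isometry yields a time integral weighted by `b r x`;
`integral_rate_mul` then averages over the type and produces `b̄`. -/
lemma integral_birthDev_mul_birthDev {Q : Measure (Measure Point)} [IsProbabilityMeasure Q]
    (hQ : IsPoissonRandomMeasure id (intensity lam π) Q)
    (hb : Measurable (Function.uncurry b)) (hl : ∫⁻ l, (l : ℝ≥0∞) ^ 2 ∂lam < ∞)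
    (hB : ∀ t, t ≠ 0 → t ≤ T → ∫⁻ y, (b t y : ℝ≥0∞) ^ 2 ∂ν ≤ B)
    (hπ : HasMomentBound π T C) {t s : ℝ≥0} (ht : t ≤ T) (hs : s ≤ T) :
    ∫ p, birthDev b lam π t p * birthDev b lam π s p ∂ν.prod Q =
      ∫ r in Iic (min t s), meanRate ν b r *
          (meanTwins lam * ∫ z, z.1 (t - r) * z.1 (s - r) ∂π +
            (∫ l, ((l : ℝ) ^ 2 - l) ∂lam) * meanPop π (t - r) * meanPop π (s - r)) ∂leb := by
  have ft := lintegral_pointFun_lt_top (ν := ν) (lam := lam) hb hl hB hπ ht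
  have fs := lintegral_pointFun_lt_top (ν := ν) (lam := lam) hb hl hB hπ hs
  have mt := measurable_uncurry_pointFun hb t
  have ms := measurable_uncurry_pointFun hb s
  simp only [birthDev_eq hb]
  refine (hQ.integral_prod_mul_prod mt ft ms fs).trans ?_
  have hm : Measurable fun r : ℝ≥0 => ∫ z : Path, z.1 (t - r) * z.1 (s - r) ∂π :=
    (((measurable_eval_sub t).mul (measurable_eval_sub s)).stronglyMeasurable.integral_prod_right'
      (f := fun p : ℝ≥0 × Path => p.2.1 (t - p.1) * p.2.1 (s - p.1))).measurable
  have hmt (t : ℝ≥0) : Measurable fun r : ℝ≥0 => meanPop π (t - r) :=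
    (measurable_meanPop π).comp (measurable_const.sub measurable_id)
  refine Eq.trans ?_ (integral_rate_mul hb hB ((min_le_left t s).trans ht)
    (g := fun r => meanTwins lam * ∫ z, z.1 (t - r) * z.1 (s - r) ∂π +
      (∫ l, ((l : ℝ) ^ 2 - l) ∂lam) * meanPop π (t - r) * meanPop π (s - r))
    ((hm.const_mul _).add (((hmt t).const_mul _).mul (hmt s)))
    (K := |meanTwins lam| * C + |∫ l, ((l : ℝ) ^ 2 - l) ∂lam| * C * C) fun r _ => ?_)
  · refine integral_congr_ae ?_
    filter_upwards [ae_integrable_memLp mt ft,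
      ae_integrable_memLp ms fs] with x hx hx'
    exact integral_pointFun_mul_pointFun lam π hl
      (fun r hr => hπ.memLp r (hr.trans (max_le ht hs))) hx.2 hx'.2
  · have h1 := hπ.abs_meanPop_le (t := t - r) (tsub_le_self.trans ht)
    have h2 := hπ.abs_meanPop_le (t := s - r) (tsub_le_self.trans hs)
    have h3 := hπ.abs_integral_mul_le (t := t - r) (s := s - r) (tsub_le_self.trans ht)
      (tsub_le_self.trans hs)
    have hC : 0 ≤ C := zero_le_one.trans hπ.one_le
    refine (abs_add_le _ _).trans ?_
    rw [abs_mul, abs_mul, abs_mul]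
    gcongr

lemma memLp_birthDev {Q : Measure (Measure Point)} [IsProbabilityMeasure Q]
    (hQ : IsPoissonRandomMeasure id (intensity lam π) Q)
    (hb : Measurable (Function.uncurry b)) (hl : ∫⁻ l, (l : ℝ≥0∞) ^ 2 ∂lam < ∞)
    (hB : ∀ t, t ≠ 0 → t ≤ T → ∫⁻ y, (b t y : ℝ≥0∞) ^ 2 ∂ν ≤ B)
    (hπ : HasMomentBound π T C) {t : ℝ≥0} (ht : t ≤ T) :
    MemLp (birthDev b lam π t) 2 (ν.prod Q) := by
  rw [birthDev_eq hb]
  exact hQ.memLp_prod (measurable_uncurry_pointFun hb t) (lintegral_pointFun_lt_top hb hl hB hπ ht)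

lemma integral_mul_birthDev {Q : Measure (Measure Point)} [IsProbabilityMeasure Q]
    (hQ : IsPoissonRandomMeasure id (intensity lam π) Q)
    (hb : Measurable (Function.uncurry b)) (hl : ∫⁻ l, (l : ℝ≥0∞) ^ 2 ∂lam < ∞)
    (hB : ∀ t, t ≠ 0 → t ≤ T → ∫⁻ y, (b t y : ℝ≥0∞) ^ 2 ∂ν ≤ B)
    (hπ : HasMomentBound π T C) {t : ℝ≥0} (ht : t ≤ T) {f : S → ℝ} (hf : MemLp f 2 ν) :
    ∫ p, f p.1 * birthDev b lam π t p ∂ν.prod Q = 0 := by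
  simp only [birthDev_eq hb]
  exact hQ.integral_fst_mul_prod (measurable_uncurry_pointFun hb t)
    (lintegral_pointFun_lt_top hb hl hB hπ ht) hf

end Birth

/-! ### Assembly of the limit theorem. -/

section Main

variable {S Ω : Type*} [MeasurableSpace S] [MeasurableSpace Ω]
  {ν : Measure S} {b : ℝ≥0 → S → ℝ≥0} {η : S → ℝ≥0} {lam : Measure ℕ} {π : Measure Path}
  {P : Measure Ω} {X : ℕ → Ω → S} {M : ℕ → Ω → Measure Point} {Z : ℕ → Ω → Path}

lemma IsCMJ.exists_hasMomentBound [IsProbabilityMeasure ν] [IsProbabilityMeasure lam]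
    [IsProbabilityMeasure π] [IsProbabilityMeasure P] (hZ : IsCMJ ν b η lam π P X M Z)
    (hb : Measurable (Function.uncurry b)) (hmom : SecondMoments ν b lam) (T : ℝ≥0) :
    ∃ C, HasMomentBound π T C := by
  obtain ⟨C, hC⟩ := hZ.exists_lintegral_sq_le hb hmom T
  have h2 (t : ℝ≥0) (ht : t ≤ T) : MemLp (fun z : Path => z.1 t) 2 π :=
    (memLp_two_iff_lintegral (measurable_eval_path t).aestronglyMeasurable).2
      ((hC t ht).trans_lt ENNReal.coe_lt_top)
  refine ⟨max 1 C, h2, le_max_left _ _, fun t ht => le_trans ?_ (le_max_right _ _)⟩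
  have h3 : ENNReal.ofReal (∫ z, z.1 t ^ 2 ∂π) ≤ C := by
    refine le_trans (le_of_eq ?_) (hC t ht)
    rw [ofReal_integral_eq_lintegral_ofReal (h2 t ht).integrable_sq
      (Eventually.of_forall fun z => sq_nonneg _)]
    refine lintegral_congr fun z => ?_
    rw [← sq_abs, ENNReal.ofReal_pow (abs_nonneg _), Real.enorm_eq_ofReal_abs]
  rw [← ENNReal.ofReal_coe_nnreal] at h3
  exact (ENNReal.ofReal_le_ofReal_iff C.2).1 h3

/-- The contributions of one ancestor to the three processes. -/
def dev (ν : Measure S) (b : ℝ≥0 → S → ℝ≥0) (η : S → ℝ≥0) (lam : Measure ℕ) (π : Measure Path)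
    (p : Fin 3 × ℝ≥0) (y : S × Measure Point) : ℝ :=
  ![lifetimeDev ν η p.2 y.1, rateDev ν b lam π p.2 y.1, birthDev b lam π p.2 y] p.1

omit [MeasurableSpace Ω] in
lemma U₁_eq (n : ℕ) (t : ℝ≥0) (ω : Ω) :
    U₁ ν η X n t ω = (√n)⁻¹ * ∑ k ∈ Finset.range n, lifetimeDev ν η t (X k ω) := by
  -- The case `n = 0` does occur, since `⌊N x⌋` may vanish; both sides are then zero.
  rcases Nat.eq_zero_or_pos n with rfl | hn
  · simp [U₁]
  have h1 : (√(n : ℝ)) ≠ 0 := (Real.sqrt_pos.2 (by exact_mod_cast hn)).ne'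
  have h2 : (n : ℝ) = √n * √n := (Real.mul_self_sqrt (Nat.cast_nonneg n)).symm
  simp only [U₁, lifetimeDev, Finset.sum_sub_distrib, Finset.sum_const, Finset.card_range,
    nsmul_eq_mul]
  generalize (∑ k ∈ Finset.range n, if t < η (X k ω) then (1 : ℝ) else 0) = A
  rw [eq_inv_mul_iff_mul_eq₀ h1, ← mul_assoc, ← h2]
  field_simp

end Main

end CMJ

end

theorem mainTheorem5 {S Ω : Type*} [MeasurableSpace S] [MeasurableSpace Ω]
    (ν : Measure S) [IsProbabilityMeasure ν]
    (b : ℝ≥0 → S → ℝ≥0) (hb : Measurable (Function.uncurry b))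
    (η : S → ℝ≥0) (hη : Measurable η)
    (lam : Measure ℕ) [IsProbabilityMeasure lam]
    (π : Measure CMJ.Path) [IsProbabilityMeasure π]
    (P : Measure Ω) [IsProbabilityMeasure P]
    (X : ℕ → Ω → S) (M : ℕ → Ω → Measure CMJ.Point) (Z : ℕ → Ω → CMJ.Path)
    (hZ : CMJ.IsCMJ ν b η lam π P X M Z)
    (hmom : CMJ.SecondMoments ν b lam)
    (x : ℝ) (hx : 0 < x) :
    ∃ (G : Measure (Fin 3 × ℝ≥0 → ℝ)) (_ : IsProbabilityMeasure G),
      -- the limit `(U₁, U₂, U₃)`, under its law `G`, is a centered Gaussian process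
      IsGaussianProcess (fun (p : Fin 3 × ℝ≥0) (u : Fin 3 × ℝ≥0 → ℝ) => u p) G ∧
      (∀ p : Fin 3 × ℝ≥0, ∫ u, u p ∂G = 0) ∧
      -- its covariances
      (∀ t s : ℝ≥0, cov[fun u => u (0, t), fun u => u (0, s); G] =
        CMJ.survival ν η (max t s) - CMJ.survival ν η t * CMJ.survival ν η s) ∧
      (∀ t s : ℝ≥0, cov[fun u => u (1, t), fun u => u (1, s); G] =
        ∫ r in Iic t, ∫ v in Iic s, CMJ.meanTwins lam ^ 2 * CMJ.meanPop π (t - r) *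
          CMJ.meanPop π (s - v) *
            cov[fun y => (b r y : ℝ), fun y => (b v y : ℝ); ν] ∂CMJ.leb ∂CMJ.leb) ∧
      (∀ t s : ℝ≥0, cov[fun u => u (2, t), fun u => u (2, s); G] =
        ∫ r in Iic (min t s), CMJ.meanRate ν b r *
          (CMJ.meanTwins lam * ∫ z, z.1 (t - r) * z.1 (s - r) ∂π +
            (∫ l, ((l : ℝ) ^ 2 - l) ∂lam) * CMJ.meanPop π (t - r) * CMJ.meanPop π (s - r))
          ∂CMJ.leb) ∧
      (∀ t s : ℝ≥0, cov[fun u => u (0, t), fun u => u (2, s); G] = 0) ∧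
      (∀ t s : ℝ≥0, cov[fun u => u (1, t), fun u => u (2, s); G] = 0) ∧
      (∀ t s : ℝ≥0, cov[fun u => u (0, t), fun u => u (1, s); G] =
        ∫ r in Iic s, CMJ.meanTwins lam * CMJ.meanPop π (s - r) *
          cov[fun y => (b r y : ℝ), fun y => if t < η y then (1 : ℝ) else 0; ν] ∂CMJ.leb) ∧
      -- convergence of all finite-dimensional distributions, with `⌊N x⌋` ancestors
      ∀ I : Finset (Fin 3 × ℝ≥0),
        TendstoInDistribution
          (fun (N : ℕ) (ω : Ω) (p : I) =>
            (![CMJ.U₁ ν η X ⌊(N : ℝ) * x⌋₊,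
               CMJ.U₂ ν b lam π X ⌊(N : ℝ) * x⌋₊,
               CMJ.U₃ b lam π X M ⌊(N : ℝ) * x⌋₊] : Fin 3 → ℝ≥0 → Ω → ℝ) p.1.1 p.1.2 ω)
          atTop
          (fun (u : Fin 3 × ℝ≥0 → ℝ) (p : I) => u p.1)
          (fun _ => P) G := by
  have hl := hmom.1
  have hMmeas (k : ℕ) := (hZ.poisson k).measurable
  set Q := P.map (M 0) with hQdef
  have : IsProbabilityMeasure Q := Measure.isProbabilityMeasure_map (hMmeas 0).aemeasurable
  have hQ : CMJ.IsPoissonRandomMeasure id (CMJ.intensity lam π) Q := (hZ.poisson 0).id_map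
  have hB (t : ℝ≥0) := hmom.exists_bound t
  have hC (t : ℝ≥0) := hZ.exists_hasMomentBound hb hmom t
  have hfst (f : S → ℝ) : ∫ y : S × Measure CMJ.Point, f y.1 ∂ν.prod Q = ∫ x, f x ∂ν := by
    rw [integral_fun_fst]; simp
  have hrate (t : ℝ≥0) : MemLp (CMJ.rateDev ν b lam π t) 2 ν := by
    obtain ⟨B, hB⟩ := hB t
    obtain ⟨C, hC⟩ := hC t
    exact CMJ.memLp_rateDev hb hB hC le_rfl
  have hbirth (t : ℝ≥0) : MemLp (CMJ.birthDev b lam π t) 2 (ν.prod Q) := by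
    obtain ⟨B, hB⟩ := hB t
    obtain ⟨C, hC⟩ := hC t
    exact CMJ.memLp_birthDev hQ hb hl hB hC le_rfl
  have hzero (t : ℝ≥0) {f : S → ℝ} (hf : MemLp f 2 ν) :
      ∫ y : S × Measure CMJ.Point, f y.1 * CMJ.birthDev b lam π t y ∂ν.prod Q = 0 := by
    obtain ⟨B, hB⟩ := hB t
    obtain ⟨C, hC⟩ := hC t
    exact CMJ.integral_mul_birthDev hQ hb hl hB hC le_rfl hf
  -- The index `(i, t)` runs over all components and times at once, so one limit law carries the
  -- cross covariances too.
  obtain ⟨G, hGp, hG, hG0, hGcov, hGlim⟩ := CMJ.exists_gaussian_limit (ν.prod Q)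
    (CMJ.dev ν b η lam π) (fun ⟨i, t⟩ => by
      fin_cases i
      · exact (CMJ.memLp_lifetimeDev hη t).comp_fst Q
      · exact (hrate t).comp_fst Q
      · exact hbirth t) (fun ⟨i, t⟩ => by
      fin_cases i
      · exact (hfst _).trans (CMJ.integral_lifetimeDev hη t)
      · obtain ⟨B, hB⟩ := hB t
        obtain ⟨C, hC⟩ := hC t
        exact (hfst _).trans (CMJ.integral_rateDev hb hB hC le_rfl)
      · have := hzero t (memLp_const (1 : ℝ))
        simp only [one_mul] at this
        exact this)
  refine ⟨G, hGp, hG, hG0, fun t s => ?_, fun t s => ?_, fun t s => ?_, fun t s => ?_,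
    fun t s => ?_, fun t s => ?_, fun I => ?_⟩
  · rw [hGcov]
    exact (hfst fun x => CMJ.lifetimeDev ν η t x * CMJ.lifetimeDev ν η s x).trans
      (CMJ.integral_lifetimeDev_mul_lifetimeDev hη t s)
  · rw [hGcov]
    obtain ⟨B, hB⟩ := hB (max t s)
    obtain ⟨C, hC⟩ := hC (max t s)
    exact (hfst fun x => CMJ.rateDev ν b lam π t x * CMJ.rateDev ν b lam π s x).trans
      (CMJ.integral_rateDev_mul_rateDev hb hB hC (le_max_left t s) (le_max_right t s))
  · rw [hGcov]
    obtain ⟨B, hB⟩ := hB (max t s)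
    obtain ⟨C, hC⟩ := hC (max t s)
    exact CMJ.integral_birthDev_mul_birthDev hQ hb hl hB hC (le_max_left t s) (le_max_right t s)
  · rw [hGcov]
    exact hzero s (CMJ.memLp_lifetimeDev hη t)
  · rw [hGcov]
    exact hzero s (hrate t)
  · rw [hGcov]
    obtain ⟨B, hB⟩ := hB s
    obtain ⟨C, hC⟩ := hC s
    exact (hfst fun x => CMJ.lifetimeDev ν η t x * CMJ.rateDev ν b lam π s x).trans
      (CMJ.integral_lifetimeDev_mul_rateDev hb hη hB hC t le_rfl)
  -- Since `x > 0`, `⌊N x⌋` tends to infinity, and the limit along `n` can be composed with it.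
  · have hfloor : Tendsto (fun N : ℕ => ⌊(N : ℝ) * x⌋₊) atTop atTop :=
      tendsto_nat_floor_atTop.comp (tendsto_natCast_atTop_atTop.atTop_mul_const hx)
    have hY (k : ℕ) : P.map (fun ω => (X k ω, M k ω)) = ν.prod Q := by
      rw [hZ.map_prod k, (hZ.poisson k).map_eq (hZ.poisson 0)]
    have h := hGlim P (fun k ω => (X k ω, M k ω))
      (fun k => (hZ.measurable_type k).prodMk (hMmeas k)) hY hZ.indep_ancestors I
    have e (N : ℕ) (ω : Ω) (p : Fin 3 × ℝ≥0) :
        (![CMJ.U₁ ν η X N, CMJ.U₂ ν b lam π X N, CMJ.U₃ b lam π X M N] :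
          Fin 3 → ℝ≥0 → Ω → ℝ) p.1 p.2 ω =
        (√N)⁻¹ * ∑ k ∈ Finset.range N, CMJ.dev ν b η lam π p (X k ω, M k ω) := by
      obtain ⟨i, t⟩ := p
      fin_cases i
      · exact CMJ.U₁_eq N t ω
      · change 1 / √N * _ = _
        rw [one_div]
        rfl
      · change 1 / √N * _ = _
        rw [one_div]
        rfl
    simp_rw [e]
    exact ⟨fun N => h.forall_aemeasurable _, h.aemeasurable_limit, h.tendsto.comp hfloor⟩
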